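/- **Setting.** Probabilistic PCF (pPCF) has the types $\sigma,\tau ::= \mathsf{nat}\mid\sigma\Rightarrow\tau$ and the simply typed terms $$M,N,P ::= \underline n \mid \mathsf{succ}(M)\mid \mathsf{pred}(M)\mid x\mid \mathsf{coin}(r)\mid \mathsf{let}(x,M,N)\mid \mathsf{if}(M,N,P)\mid (M)N\mid \lambda x^\sigma M\mid \mathsf{fix}(M),$$ where $r\in[0,1]\cap\mathbb Q$, $\mathsf{coin}(r):\mathsf{nat}$ yields $\underline 0$ with probability $r$ and $\underline 1$ with probability $1-r$, $\mathsf{if}$ tests whether its first argument (of type $\mathsf{nat}$) is $\underline 0$, and $\mathsf{let}(x,M,N)$ with $M:\mathsf{nat}$ samples an integer from $M$ and binds it to $x:\mathsf{nat}$ in $N$. For a finite set $L$ of labels, the labeled terms over $L$ have in addition the construct $M^l$ ($l\in L$), typed like $M$; $\mathsf{strip}(M)$ is $M$ with all labels removed. *Operational semantics.* A state is a pair $\langle M,\pi\rangle$ of a closed term and a stack of pending arguments and pending $\mathsf{succ}$, $\mathsf{pred}$, $\mathsf{if}$, $\mathsf{let}$ operations. States are evaluated by weak head reduction (call by name; $\mathsf{succ}$,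 $\mathsf{pred}$, $\mathsf{if}$, $\mathsf{let}$ first evaluate their first argument), along a finite sequence $\alpha\in\{0,1\}^{<\omega}$ of coin results: $\langle\mathsf{coin}(r),\pi\rangle$ consumes the first element $i$ of $\alpha$ and continues as $\langle\underline i,\pi\rangle$. The evaluation of a state $s$ along $\alpha$ succeeds if it reaches $\underline 0$ with empty stack having consumed exactly $\alpha$; for an unlabeled $s$, let $\mathcal D(s)$ be the set of these $\alpha$ and $\mathrm{Ev}(s,\alpha)$ the product of the probabilities of the coin results. Let $\mathbb P_s$ be the probability measure on $\{0,1\}^{<\omega}$ giving mass $\mathrm{Ev}(s,\beta)$ to $0\beta$ for $\beta\in\mathcal D(s)$ and the remaining mass to the one-element sequence $\langle 1\rangle$; the event "$s$ converges to $0$" is $(s\downarrow\underline 0)=\{0\beta\mid\beta\in\mathcal D(s)\}$. For a labeled state $s$, $\langle M^l,\pi\rangle$ continues as $\langle M,\pi\rangle$ and counts one occurrence of $l$ in head position; the random variable $\mathrm{Ev}_l(s):\{0,1\}^{<\omega}\to\mathbb N$ maps $0\beta$, for $\beta\in\mathcal D(\mathsf{strip}(s))$, to the number of times $l$ is so counted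 in the evaluation of $s$ along $\beta$, and all other sequences to $0$. *Denotational semantics.* $[\![M]\!]$ is the interpretation of an unlabeled term in the Kleisli category of the exponential $!$ of probabilistic coherence spaces: $[\![\mathsf{nat}]\!]$ is the space of subprobability distributions on $\mathbb N$, $[\![\sigma\Rightarrow\tau]\!]={!}[\![\sigma]\!]\multimap[\![\tau]\!]$, contexts are interpreted by products, and a term $x_1:\sigma_1,\dots,x_k:\sigma_k\vdash M:\sigma$ is interpreted as a matrix (a power series with nonnegative coefficients) inducing a function $\prod_i\mathrm P[\![\sigma_i]\!]\to\mathrm P[\![\sigma]\!]$, with the usual clauses; $\mathsf{fix}(M)$ is interpreted as $\sup_n[\![M]\!]^n(0)$. *Spy translation.* Let $\vec x=(x_l)_{l\in L}$ be pairwise distinct variables of type $\mathsf{nat}$. $\mathsf{sp}_{\vec x}$ maps labeled terms to unlabeled ones, commutes with all constructs except labeling, and $\mathsf{sp}_{\vec x}(M^l)=\mathsf{if}(x_l,\mathsf{sp}_{\vec x}(M),\Omega^\sigma)$, where $\sigma$ is the type of $M$ and $\Omega^\sigma=\mathsf{fix}(\lambda x^\sigma x)$. For $\vec r\in[0,1]^L$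 let $\vec r\,e_0=(r_l\,e_0)_{l\in L}$, where $e_0$ is the Dirac distribution at $0$. **Theorem.** Let $L$ be a finite set of labels, $M$ a closed labeled term over $L$ of type $\mathsf{nat}$, and $l\in L$. Write $s=\langle M,\varepsilon\rangle$ with $\varepsilon$ the empty stack. Then the function $$f:[0,1]^L\to[0,1],\qquad f(\vec r)=[\![\mathsf{sp}_{\vec x}(M)]\!](\vec r\,e_0)_0$$ has a partial derivative in $r_l$ at $(1,\dots,1)$, in the sense that the difference quotient has a limit in $[0,\infty]$ as $r_l\to1$ within $[0,1)$ (the value $\infty$ is possible), and $$\mathbb E\bigl(\mathrm{Ev}_l(s)\bigm|\mathsf{strip}(s)\downarrow\underline 0\bigr)=\frac{\partial f}{\partial r_l}(1,\dots,1)\Big/[\![\mathsf{strip}(M)]\!]_0$$ as elements of $[0,\infty]$, the expectation being with respect to $\mathbb P_{\mathsf{strip}(s)}$. If the event of convergence has probability $0$, the conditional expectation is by convention $0$, and the equality holds with $0/0=0$; in particular the derivative is then $0$. -/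

import Mathlib

open scoped ENNReal NNReal Topology

universe u

noncomputable section

namespace PPCF

/-! ## Probabilistic coherence spaces -/

/-- The pairing `⟨u, u'⟩ = ∑ i, u i * u' i`. -/
def pair {I : Type} (u u' : I → ℝ≥0∞) : ℝ≥0∞ := ∑' i, u i * u' i

/-- The polar of a set of vectors. -/
def orth {I : Type} (P : Set (I → ℝ≥0∞)) : Set (I → ℝ≥0∞) :=
  {u' | ∀ u ∈ P, pair u u' ≤ 1}

theorem pair_comm {I : Type} (u v : I → ℝ≥0∞) : pair u v = pair v u := by
  simp only [pair, mul_comm]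

theorem subset_biorth {I : Type} (P : Set (I → ℝ≥0∞)) : P ⊆ orth (orth P) := by
  intro x hx y hy
  rw [pair_comm]
  exact hy x hx

theorem orth_anti {I : Type} {P Q : Set (I → ℝ≥0∞)} (h : P ⊆ Q) : orth Q ⊆ orth P :=
  fun _ hx u hu => hx u (h hu)

theorem orth_biorth {I : Type} (P : Set (I → ℝ≥0∞)) : orth (orth (orth P)) = orth P :=
  Set.Subset.antisymm (orth_anti (subset_biorth P)) (subset_biorth _)

/-- A probabilistic coherence space: an at most countable web together with a set `P` of
vectors which is its own bipolar, reaches every point of the web, and is bounded at every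
point of the web. -/
structure PCS where
  Web : Type
  countable : Countable Web
  P : Set (Web → ℝ≥0∞)
  biorth : orth (orth P) = P
  pos : ∀ a, ∃ x ∈ P, 0 < x a
  bdd : ∀ a, ∃ m : ℝ≥0, ∀ x ∈ P, x a ≤ m

theorem PCS.mem_of {X : PCS} {x : X.Web → ℝ≥0∞} (h : ∀ y ∈ orth X.P, pair x y ≤ 1) :
    x ∈ X.P := by
  rw [← X.biorth]
  intro y hy
  rw [pair_comm]
  exact h y hy

theorem PCS.zero_mem (X : PCS) : (fun _ => 0) ∈ X.P :=
  PCS.mem_of fun y _ => by simp [pair]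

theorem PCS.mono {X : PCS} {x y : X.Web → ℝ≥0∞} (hy : y ∈ X.P) (h : ∀ a, x a ≤ y a) :
    x ∈ X.P :=
  PCS.mem_of fun _ hz =>
    (ENNReal.tsum_le_tsum fun a => mul_le_mul_left (h a) _).trans (hz y hy)

/-- Closure of `P` under subconvex combinations. -/
theorem PCS.sum_mem {X : PCS} {J : Type} (c : J → ℝ≥0∞) (hc : ∑' j, c j ≤ 1)
    (x : J → X.Web → ℝ≥0∞) (hx : ∀ j, x j ∈ X.P) : (fun a => ∑' j, c j * x j a) ∈ X.P := by
  refine PCS.mem_of fun y hy => ?_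
  have : pair (fun a => ∑' j, c j * x j a) y = ∑' j, c j * pair (x j) y := by
    simp only [pair, ← ENNReal.tsum_mul_right, ← ENNReal.tsum_mul_left]
    rw [ENNReal.tsum_comm]
    simp only [mul_assoc]
  rw [this]
  refine le_trans (ENNReal.tsum_le_tsum fun j => ?_) hc
  calc c j * pair (x j) y ≤ c j * 1 := mul_le_mul_right (hy _ (hx j)) _
    _ = c j := mul_one _

theorem PCS.smul_mem {X : PCS} {c : ℝ≥0∞} (hc : c ≤ 1) {x : X.Web → ℝ≥0∞} (hx : x ∈ X.P) :
    (fun a => c * x a) ∈ X.P := by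
  have := PCS.sum_mem (X := X) (J := Unit) (fun _ => c) (by simpa using hc) (fun _ => x)
    (fun _ => hx)
  simpa using this

theorem PCS.add_mem {X : PCS} {c d : ℝ≥0∞} (hc : c + d ≤ 1) {x y : X.Web → ℝ≥0∞}
    (hx : x ∈ X.P) (hy : y ∈ X.P) : (fun a => c * x a + d * y a) ∈ X.P := by
  have := PCS.sum_mem (X := X) (J := Bool) (fun b => if b then c else d)
    (by simpa [tsum_fintype] using hc) (fun b => if b then x else y)
    (fun b => by cases b <;> simpa)
  simpa [tsum_fintype] using this

theorem tsum_iSup_of_monotone {I : Type} (f : ℕ → I → ℝ≥0∞) (hf : Monotone f) :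
    ∑' i, ⨆ n, f n i = ⨆ n, ∑' i, f n i := by
  let _ : MeasurableSpace I := ⊤
  have h := MeasureTheory.lintegral_iSup (μ := MeasureTheory.Measure.count) (f := f)
    (fun n => measurable_from_top) hf
  simpa [MeasureTheory.lintegral_count' measurable_from_top] using h

theorem PCS.iSup_mem {X : PCS} (x : ℕ → X.Web → ℝ≥0∞) (hm : Monotone x)
    (hx : ∀ n, x n ∈ X.P) : (fun a => ⨆ n, x n a) ∈ X.P := by
  refine PCS.mem_of fun y hy => ?_
  have : pair (fun a => ⨆ n, x n a) y = ⨆ n, pair (x n) y := by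
    simp only [pair, ENNReal.iSup_mul]
    exact tsum_iSup_of_monotone _ fun i j hij a => mul_le_mul_left (hm hij a) _
  rw [this]
  exact iSup_le fun n => hy _ (hx n)

theorem PCS.pos_finset (X : PCS) (S : Finset X.Web) : ∃ x ∈ X.P, ∀ a ∈ S, 0 < x a := by
  classical
  induction S using Finset.induction_on with
  | empty => exact ⟨_, X.zero_mem, by simp⟩
  | insert a S _ ih =>
    obtain ⟨x, hx, hx0⟩ := ih
    obtain ⟨y, hy, hy0⟩ := X.pos a
    refine ⟨_, PCS.add_mem (c := 2⁻¹) (d := 2⁻¹) (ENNReal.inv_two_add_inv_two.le) hx hy, ?_⟩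
    have h2 : (0 : ℝ≥0∞) < 2⁻¹ := by simp
    intro b hb
    rcases Finset.mem_insert.1 hb with rfl | hb
    · exact (ENNReal.mul_pos h2.ne' hy0.ne').trans_le le_add_self
    · exact (ENNReal.mul_pos h2.ne' (hx0 b hb).ne').trans_le le_self_add

/-- The space of subprobability distributions on `ℕ`. -/
def snat : PCS where
  Web := ℕ
  countable := inferInstance
  P := {x | ∑' n, x n ≤ 1}
  biorth := by
    refine Set.Subset.antisymm (fun x hx => ?_) (subset_biorth _)
    have := hx (fun _ => 1) (fun u hu => by simpa [pair] using hu)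
    simpa [pair] using this
  pos := fun a => ⟨fun n => if n = a then 1 else 0, by simp, by simp⟩
  bdd := fun a => ⟨1, fun x hx => (ENNReal.le_tsum a).trans (by simpa using hx)⟩

/-- The empty product. -/
def topPCS : PCS where
  Web := Empty
  countable := inferInstance
  P := Set.univ
  biorth := Set.Subset.antisymm (Set.subset_univ _) (subset_biorth _)
  pos := fun a => a.elim
  bdd := fun a => a.elim

/-- The binary cartesian product `X & Y`. -/
def prodPCS (X Y : PCS) : PCS where
  Web := X.Web ⊕ Y.Web
  countable := by
    have := X.countable
    have := Y.countable
    infer_instance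
  P := {x | (fun a => x (Sum.inl a)) ∈ X.P ∧ (fun b => x (Sum.inr b)) ∈ Y.P}
  biorth := by
    refine Set.Subset.antisymm (fun x hx => ⟨?_, ?_⟩) (subset_biorth _)
    · refine PCS.mem_of fun y hy => ?_
      have := hx (Sum.elim y fun _ => 0) (fun u hu => by
        simpa [pair, ENNReal.summable.tsum_sum] using hy _ hu.1)
      rw [pair_comm]
      simpa [pair, ENNReal.summable.tsum_sum] using this
    · refine PCS.mem_of fun y hy => ?_
      have := hx (Sum.elim (fun _ => 0) y) (fun u hu => by
        simpa [pair, ENNReal.summable.tsum_sum] using hy _ hu.2)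
      rw [pair_comm]
      simpa [pair, ENNReal.summable.tsum_sum] using this
  pos := by
    rintro (a | b)
    · obtain ⟨x, hx, h⟩ := X.pos a
      exact ⟨Sum.elim x fun _ => 0, ⟨hx, Y.zero_mem⟩, h⟩
    · obtain ⟨x, hx, h⟩ := Y.pos b
      exact ⟨Sum.elim (fun _ => 0) x, ⟨X.zero_mem, hx⟩, h⟩
  bdd := by
    rintro (a | b)
    · obtain ⟨m, hm⟩ := X.bdd a
      exact ⟨m, fun x hx => hm _ hx.1⟩
    · obtain ⟨m, hm⟩ := Y.bdd b
      exact ⟨m, fun x hx => hm _ hx.2⟩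

/-- Application of a matrix to a vector. -/
def matApp {I J : Type} (t : I × J → ℝ≥0∞) (u : I → ℝ≥0∞) (j : J) : ℝ≥0∞ :=
  ∑' i, t (i, j) * u i

theorem pair_matApp {I J : Type} (t : I × J → ℝ≥0∞) (u : I → ℝ≥0∞) (v : J → ℝ≥0∞) :
    pair (matApp t u) v = pair t fun p => u p.1 * v p.2 := by
  simp only [pair, matApp, ENNReal.tsum_prod', ← ENNReal.tsum_mul_right]
  rw [ENNReal.tsum_comm]
  simp only [mul_assoc]

/-- The linear function space: the matrices mapping `P X` to `P Y`. -/
def lin (X Y : PCS) : PCS where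
  Web := X.Web × Y.Web
  countable := by
    have := X.countable
    have := Y.countable
    infer_instance
  P := {t | ∀ x ∈ X.P, matApp t x ∈ Y.P}
  biorth := by
    refine Set.Subset.antisymm (fun t ht x hx => ?_) (subset_biorth _)
    refine PCS.mem_of fun y hy => ?_
    rw [pair_matApp, pair_comm]
    refine ht _ fun t' ht' => ?_
    rw [← pair_matApp]
    exact hy _ (ht' x hx)
  pos := by
    classical
    rintro ⟨a, b⟩
    obtain ⟨m, hm⟩ := X.bdd a
    obtain ⟨y, hy, hy0⟩ := Y.pos b
    refine ⟨fun p => if p.1 = a then ((max m 1 : ℝ≥0) : ℝ≥0∞)⁻¹ * y p.2 else 0,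
      fun x hx => ?_, ?_⟩
    · have h1 : ((max m 1 : ℝ≥0) : ℝ≥0∞)⁻¹ * x a ≤ 1 := by
        have h2 : x a ≤ ((max m 1 : ℝ≥0) : ℝ≥0∞) :=
          (hm x hx).trans (by exact_mod_cast le_max_left _ _)
        calc _ ≤ ((max m 1 : ℝ≥0) : ℝ≥0∞)⁻¹ * ((max m 1 : ℝ≥0) : ℝ≥0∞) :=
              mul_le_mul_right h2 _
          _ ≤ 1 := ENNReal.inv_mul_le_one _
      refine PCS.mono (PCS.smul_mem h1 hy) fun c => le_of_eq ?_
      simp only [matApp, ite_mul, zero_mul, tsum_ite_eq]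
      ring
    · simp only [if_true]
      exact ENNReal.mul_pos (by simp) hy0.ne'
  bdd := by
    rintro ⟨a, b⟩
    obtain ⟨x, hx, hx0⟩ := X.pos a
    obtain ⟨m, hm⟩ := Y.bdd b
    obtain ⟨m', hm'⟩ := X.bdd a
    have hxt : x a ≠ ⊤ := ((hm' x hx).trans_lt ENNReal.coe_lt_top).ne
    refine ⟨((m : ℝ≥0∞) / x a).toNNReal, fun t ht => ?_⟩
    rw [ENNReal.coe_toNNReal (ENNReal.div_lt_top ENNReal.coe_ne_top hx0.ne').ne,
      ENNReal.le_div_iff_mul_le (Or.inl hx0.ne') (Or.inl hxt)]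
    exact (ENNReal.le_tsum (f := fun i => t (i, b) * x i) a).trans (hm _ (ht x hx))

/-- The promotion of `x`: the family of the monomials `x ^ μ`, for `μ` a finite multiset. -/
def prom {I : Type} (x : I → ℝ≥0∞) (μ : I →₀ ℕ) : ℝ≥0∞ := μ.prod fun a k => x a ^ k

/-- The exponential; finite multisets are finitely supported functions to `ℕ`. -/
def excl (X : PCS) : PCS where
  Web := X.Web →₀ ℕ
  countable := by
    have := X.countable
    infer_instance
  P := orth (orth (prom '' X.P))
  biorth := orth_biorth _
  pos := by
    intro μ
    obtain ⟨x, hx, hx0⟩ := X.pos_finset μ.support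
    refine ⟨prom x, subset_biorth _ ⟨x, hx, rfl⟩, ?_⟩
    rw [pos_iff_ne_zero]
    exact Finset.prod_ne_zero_iff.2 fun a ha => pow_ne_zero _ (hx0 a ha).ne'
  bdd := by
    classical
    intro μ
    choose m hm using X.bdd
    let B : ℝ≥0 := μ.prod fun a k => (max (m a) 1) ^ k
    have hB : B ≠ 0 :=
      Finset.prod_ne_zero_iff.2 fun a _ => pow_ne_zero _ (by positivity)
    have hB' : (B : ℝ≥0∞) ≠ 0 := by exact_mod_cast hB
    have hle : ∀ x ∈ X.P, prom x μ ≤ B := by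
      intro x hx
      simp only [B, Finsupp.prod, prom, ENNReal.ofNNReal_finsetProd, ENNReal.coe_pow]
      refine Finset.prod_le_prod' fun a _ => pow_le_pow_left' ((hm a x hx).trans ?_) _
      exact_mod_cast le_max_left _ _
    refine ⟨B, fun u hu => ?_⟩
    have := hu (fun ν => if ν = μ then (B : ℝ≥0∞)⁻¹ else 0) (by
      rintro _ ⟨x, hx, rfl⟩
      simp only [pair, mul_ite, mul_zero, tsum_ite_eq]
      rw [← div_eq_mul_inv]
      exact ENNReal.div_le_of_le_mul (by simpa using hle x hx))
    simp only [pair, ite_mul, zero_mul, tsum_ite_eq] at this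
    rw [mul_comm, ← div_eq_mul_inv] at this
    simpa using (ENNReal.div_le_iff hB' ENNReal.coe_ne_top).1 this

/-- Morphisms `X → Y` of the Kleisli category of the exponential. -/
def Kl (X Y : PCS) : Type := (lin (excl X) Y).P

theorem matApp_prom_mem {X Y : PCS} {t : (X.Web →₀ ℕ) × Y.Web → ℝ≥0∞}
    (ht : t ∈ (lin (excl X) Y).P) {x : X.Web → ℝ≥0∞} (hx : x ∈ X.P) :
    matApp t (prom x) ∈ Y.P :=
  ht _ (subset_biorth _ ⟨x, hx, rfl⟩)

theorem mem_lin_excl {X Y : PCS} {t : (X.Web →₀ ℕ) × Y.Web → ℝ≥0∞}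
    (ht : ∀ x ∈ X.P, matApp t (prom x) ∈ Y.P) : t ∈ (lin (excl X) Y).P := by
  intro u hu
  refine PCS.mem_of fun y hy => ?_
  have h := hu (fun i : X.Web →₀ ℕ => ∑' j, t (i, j) * y j) (by
    rintro _ ⟨x, hx, rfl⟩
    refine le_trans (le_of_eq ?_) (hy _ (ht x hx))
    simp only [pair, matApp, ← ENNReal.tsum_mul_right, ← ENNReal.tsum_mul_left]
    rw [ENNReal.tsum_comm]
    simp only [mul_comm, mul_left_comm])
  refine le_trans (le_of_eq ?_) h
  simp only [pair, matApp, ← ENNReal.tsum_mul_right]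
  rw [ENNReal.tsum_comm]
  simp only [mul_comm, mul_left_comm]
  rfl

/-- The function `P X → P Y`, `x ↦ (∑ μ, t (μ, b) * x ^ μ)_b`, of a Kleisli morphism `t`. -/
def Kl.toFun {X Y : PCS} (t : Kl X Y) (x : X.P) : Y.P :=
  ⟨matApp t.1 (prom x.1), matApp_prom_mem t.2 x.2⟩

/-! ## Syntax -/

inductive Ty : Type
  | nat : Ty
  | arr : Ty → Ty → Ty

/-- Typed de Bruijn variables: `Var Γ σ` are the variables of type `σ` of the context `Γ`. -/
inductive Var : List Ty → Ty → Type
  | zero {Γ : List Ty} {σ : Ty} : Var (σ :: Γ) σ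
  | succ {Γ : List Ty} {σ τ : Ty} : Var Γ σ → Var (τ :: Γ) σ

/-- `Tm L Γ σ`: the terms of type `σ` in context `Γ` of the language whose terms can be marked
by labels from `L`. Terms are identified with their typing derivations and bound variables
are nameless. The construct `letin` binds a variable of type `nat` in its second argument. -/
inductive Tm (L : Type u) : List Ty → Ty → Type u
  | var {Γ : List Ty} {σ : Ty} : Var Γ σ → Tm L Γ σ
  | num {Γ : List Ty} : ℕ → Tm L Γ Ty.nat
  | succ {Γ : List Ty} : Tm L Γ Ty.nat → Tm L Γ Ty.nat
  | pred {Γ : List Ty} : Tm L Γ Ty.nat → Tm L Γ Ty.nat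
  | dice {Γ : List Ty} : Set.Icc (0 : ℚ) 1 → Tm L Γ Ty.nat
  | letin {Γ : List Ty} {σ : Ty} : Tm L Γ Ty.nat → Tm L (Ty.nat :: Γ) σ → Tm L Γ σ
  | ifz {Γ : List Ty} {σ : Ty} : Tm L Γ Ty.nat → Tm L Γ σ → Tm L Γ σ → Tm L Γ σ
  | app {Γ : List Ty} {σ τ : Ty} : Tm L Γ (Ty.arr σ τ) → Tm L Γ σ → Tm L Γ τ
  | lam {Γ : List Ty} {σ τ : Ty} : Tm L (σ :: Γ) τ → Tm L Γ (Ty.arr σ τ)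
  | fix {Γ : List Ty} {σ : Ty} : Tm L Γ (Ty.arr σ σ) → Tm L Γ σ
  | mark {Γ : List Ty} {σ : Ty} : Tm L Γ σ → L → Tm L Γ σ

/-- The unlabeled language. -/
abbrev PTm : List Ty → Ty → Type := Tm Empty

def Ren (Γ Δ : List Ty) : Type := ∀ σ : Ty, Var Γ σ → Var Δ σ

def Ren.lift {Γ Δ : List Ty} (ρ : Ren Γ Δ) (τ : Ty) : Ren (τ :: Γ) (τ :: Δ)
  | _, .zero => .zero
  | _, .succ x => .succ (ρ _ x)

def Tm.rename {L : Type u} : {Γ Δ : List Ty} → {σ : Ty} → Ren Γ Δ → Tm L Γ σ → Tm L Δ σ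
  | _, _, _, ρ, .var x => .var (ρ _ x)
  | _, _, _, _, .num n => .num n
  | _, _, _, ρ, .succ M => .succ (M.rename ρ)
  | _, _, _, ρ, .pred M => .pred (M.rename ρ)
  | _, _, _, _, .dice r => .dice r
  | _, _, _, ρ, .letin M N => .letin (M.rename ρ) (N.rename (ρ.lift _))
  | _, _, _, ρ, .ifz M N P => .ifz (M.rename ρ) (N.rename ρ) (P.rename ρ)
  | _, _, _, ρ, .app M N => .app (M.rename ρ) (N.rename ρ)
  | _, _, _, ρ, .lam M => .lam (M.rename (ρ.lift _))
  | _, _, _, ρ, .fix M => .fix (M.rename ρ)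
  | _, _, _, ρ, .mark M l => .mark (M.rename ρ) l

def Sub (L : Type u) (Γ Δ : List Ty) : Type u := ∀ σ : Ty, Var Γ σ → Tm L Δ σ

def Sub.lift {L : Type u} {Γ Δ : List Ty} (θ : Sub L Γ Δ) (τ : Ty) : Sub L (τ :: Γ) (τ :: Δ)
  | _, .zero => .var .zero
  | _, .succ x => (θ _ x).rename fun _ y => .succ y

def Tm.subst {L : Type u} : {Γ Δ : List Ty} → {σ : Ty} → Sub L Γ Δ → Tm L Γ σ → Tm L Δ σ
  | _, _, _, θ, .var x => θ _ x
  | _, _, _, _, .num n => .num n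
  | _, _, _, θ, .succ M => .succ (M.subst θ)
  | _, _, _, θ, .pred M => .pred (M.subst θ)
  | _, _, _, _, .dice r => .dice r
  | _, _, _, θ, .letin M N => .letin (M.subst θ) (N.subst (θ.lift _))
  | _, _, _, θ, .ifz M N P => .ifz (M.subst θ) (N.subst θ) (P.subst θ)
  | _, _, _, θ, .app M N => .app (M.subst θ) (N.subst θ)
  | _, _, _, θ, .lam M => .lam (M.subst (θ.lift _))
  | _, _, _, θ, .fix M => .fix (M.subst θ)
  | _, _, _, θ, .mark M l => .mark (M.subst θ) l

def Sub.single {L : Type u} {Γ : List Ty} {τ : Ty} (N : Tm L Γ τ) : Sub L (τ :: Γ) Γ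
  | _, .zero => N
  | _, .succ x => .var x

/-- `M.inst N` is `M[N/x]`, where `x` is the last variable of the context of `M`. -/
def Tm.inst {L : Type u} {Γ : List Ty} {σ τ : Ty} (M : Tm L (τ :: Γ) σ) (N : Tm L Γ τ) :
    Tm L Γ σ :=
  M.subst (Sub.single N)

/-- Removal of all labels. -/
def Tm.strip {L : Type u} : {Γ : List Ty} → {σ : Ty} → Tm L Γ σ → PTm Γ σ
  | _, _, .var x => .var x
  | _, _, .num n => .num n
  | _, _, .succ M => .succ M.strip
  | _, _, .pred M => .pred M.strip
  | _, _, .dice r => .dice r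
  | _, _, .letin M N => .letin M.strip N.strip
  | _, _, .ifz M N P => .ifz M.strip N.strip P.strip
  | _, _, .app M N => .app M.strip N.strip
  | _, _, .lam M => .lam M.strip
  | _, _, .fix M => .fix M.strip
  | _, _, .mark M _ => M.strip

/-- The always diverging term `fix (λ x. x)`. -/
def loop (Γ : List Ty) (σ : Ty) : PTm Γ σ := .fix (.lam (.var .zero))

/-- The spy translation: each `mark M l` becomes `if x l then M else loop`. The variables of
`Γ` are transported to the target context `Δ` by `ρ`, and `x` gives the spy variables. -/
def Tm.spy {L : Type u} : {Γ Δ : List Ty} → {σ : Ty} → Ren Γ Δ → (L → Var Δ Ty.nat) →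
    Tm L Γ σ → PTm Δ σ
  | _, _, _, ρ, _, .var y => .var (ρ _ y)
  | _, _, _, _, _, .num n => .num n
  | _, _, _, ρ, x, .succ M => .succ (M.spy ρ x)
  | _, _, _, ρ, x, .pred M => .pred (M.spy ρ x)
  | _, _, _, _, _, .dice r => .dice r
  | _, _, _, ρ, x, .letin M N =>
      .letin (M.spy ρ x) (N.spy (ρ.lift _) fun l => .succ (x l))
  | _, _, _, ρ, x, .ifz M N P => .ifz (M.spy ρ x) (N.spy ρ x) (P.spy ρ x)
  | _, _, _, ρ, x, .app M N => .app (M.spy ρ x) (N.spy ρ x)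
  | _, _, _, ρ, x, .lam M => .lam (M.spy (ρ.lift _) fun l => .succ (x l))
  | _, _, _, ρ, x, .fix M => .fix (M.spy ρ x)
  | _, _, _, ρ, x, .mark M l => .ifz (.var (x l)) (M.spy ρ x) (loop _ _)

/-- The context consisting of `n` variables of type `nat`. -/
def natCtx : ℕ → List Ty
  | 0 => []
  | n + 1 => Ty.nat :: natCtx n

def natVar : (n : ℕ) → Fin n → Var (natCtx n) Ty.nat
  | 0, i => i.elim0
  | n + 1, i => Fin.cases (motive := fun _ => Var (natCtx (n + 1)) Ty.nat)
      .zero (fun j => .succ (natVar n j)) i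

def Ren.ofNil (Δ : List Ty) : Ren [] Δ := fun _ y => nomatch y

/-- The spy translation of a closed term, with one spy variable for each label; the labels are
enumerated by `e`. -/
def spyClosed {L : Type u} {n : ℕ} (e : L ≃ Fin n) {σ : Ty} (M : Tm L [] σ) :
    PTm (natCtx n) σ :=
  M.spy (Ren.ofNil _) fun l => natVar n (e l)

/-! ## Denotational semantics -/

def Ty.sem : Ty → PCS
  | .nat => snat
  | .arr σ τ => lin (excl σ.sem) τ.sem

/-- A context is interpreted as the product of the interpretations of its types. -/
def ctxSem : List Ty → PCS
  | [] => topPCS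
  | σ :: Γ => prodPCS σ.sem (ctxSem Γ)

/-- A power series with coefficients in `[0, ∞]`; the product is the Cauchy product. -/
abbrev Ser (A : Type) : Type := MvPowerSeries A ℝ≥0∞

/-- The sum of an arbitrary family of power series, computed coefficient by coefficient. -/
def serSum {J A : Type} (f : J → Ser A) : Ser A := fun μ => ∑' j, f j μ

/-- Application of a family of matrices `t`, depending analytically on a parameter, to a
family of vectors `s` depending on the same parameter:
`(t(u)(s(u)))_b = ∑ m, t(u)_(m,b) * s(u) ^ m`. -/
def serApp {A B C : Type} (t : (A →₀ ℕ) × B → Ser C) (s : A → Ser C) (b : B) : Ser C :=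
  serSum fun m : A →₀ ℕ => t (m, b) * m.prod fun a k => s a ^ k

/-- Currying of a family of power series in the variables `A ⊕ C`. -/
def serLam {A B C : Type} (t : B → Ser (A ⊕ C)) (p : (A →₀ ℕ) × B) : Ser C :=
  fun μ => t p.2 (p.1.sumElim μ)

/-- The least fixed point, supremum of the iterates from `0`. -/
def serFix {A C : Type} (t : (A →₀ ℕ) × A → Ser C) (a : A) : Ser C :=
  fun μ => ⨆ n : ℕ, (serApp t)^[n] (fun _ => 0) a μ

/-- The basis vector `e_n`, as a family of constant power series. -/
def serNum {C : Type} (n k : ℕ) : Ser C := if k = n then 1 else 0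

/-- The position of the web of a variable in the web of its context. -/
def varPos : {Γ : List Ty} → {σ : Ty} → Var Γ σ → σ.sem.Web → (ctxSem Γ).Web
  | _, _, .zero => Sum.inl
  | _, _, .succ x => fun a => Sum.inr (varPos x a)

/-- The interpretation of a term, as the family of power series indexed by the web of its type,
with variables in the web of its context. -/
def ser : {Γ : List Ty} → {σ : Ty} → PTm Γ σ → σ.sem.Web → Ser (ctxSem Γ).Web
  | _, _, .var x => fun a => MvPowerSeries.X (varPos x a)
  | _, _, .num n => fun k : ℕ => serNum n k
  | _, _, .succ M => fun k : ℕ => serSum fun n : ℕ => if k = n + 1 then ser M n else 0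
  | _, _, .pred M => fun k : ℕ => serSum fun n : ℕ => if k = n - 1 then ser M n else 0
  | _, _, .dice r => fun k : ℕ =>
      ENNReal.ofReal r.1 • serNum 0 k + ENNReal.ofReal (1 - r.1) • serNum 1 k
  | _, _, .letin M N => fun a =>
      serSum fun n : ℕ => ser M n * serApp (serLam (ser N)) (serNum n) a
  | _, _, .ifz M N P => fun a =>
      ser M (0 : ℕ) * ser N a + (serSum fun n : ℕ => ser M (n + 1 : ℕ)) * ser P a
  | _, _, .app M N => serApp (ser M) (ser N)
  | _, _, .lam M => serLam (ser M)
  | _, _, .fix M => serFix (ser M)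
  | _, _, .mark _ l => l.elim

/-- The value of a power series at a point. -/
def serVal {A : Type} (f : Ser A) (x : A → ℝ≥0∞) : ℝ≥0∞ := ∑' μ, f μ * prom x μ

section Val

variable {A B C J : Type} (x : A → ℝ≥0∞)

theorem prom_add (μ ν : A →₀ ℕ) : prom x (μ + ν) = prom x μ * prom x ν :=
  Finsupp.prod_add_index' (fun _ => pow_zero _) fun _ _ _ => pow_add _ _ _

theorem serVal_monomial (μ : A →₀ ℕ) (c : ℝ≥0∞) :
    serVal (MvPowerSeries.monomial μ c) x = c * prom x μ := by
  classical
  have : ∀ ν, MvPowerSeries.monomial μ c ν = if ν = μ then c else 0 :=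
    fun ν => MvPowerSeries.coeff_monomial ν μ c
  simp only [serVal, this, ite_mul, zero_mul, tsum_ite_eq]

theorem serVal_X (a : A) : serVal (MvPowerSeries.X a) x = x a := by
  rw [MvPowerSeries.X, serVal_monomial]
  simp [prom]

theorem serVal_one : serVal (1 : Ser A) x = 1 := by
  rw [← MvPowerSeries.monomial_zero_one, serVal_monomial]
  simp [prom]

theorem serVal_zero : serVal (0 : Ser A) x = 0 := by
  have : ∀ ν, (0 : Ser A) ν = 0 := fun _ => rfl
  simp [serVal, this]

theorem serVal_add (f g : Ser A) : serVal (f + g) x = serVal f x + serVal g x := by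
  have : ∀ ν, (f + g) ν = f ν + g ν := fun _ => rfl
  simp only [serVal, this, add_mul, ENNReal.tsum_add]

theorem serVal_smul (c : ℝ≥0∞) (f : Ser A) : serVal (c • f) x = c * serVal f x := by
  have : ∀ ν, (c • f) ν = c * f ν := fun _ => rfl
  simp only [serVal, this, mul_assoc, ENNReal.tsum_mul_left]

theorem serVal_mul (f g : Ser A) : serVal (f * g) x = serVal f x * serVal g x := by
  classical
  have h : ∀ μ, (f * g) μ * prom x μ =
      ∑' p : Finset.HasAntidiagonal.antidiagonal μ, (f p.1.1 * prom x p.1.1) * (g p.1.2 * prom x p.1.2) := by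
    intro μ
    have h1 : (f * g) μ = ∑ p ∈ Finset.HasAntidiagonal.antidiagonal μ, f p.1 * g p.2 :=
      MvPowerSeries.coeff_mul μ f g
    rw [h1, Finset.sum_mul, Finset.tsum_subtype (Finset.HasAntidiagonal.antidiagonal μ)
      (fun p => (f p.1 * prom x p.1) * (g p.2 * prom x p.2))]
    refine Finset.sum_congr rfl fun p hp => ?_
    rw [← Finset.HasAntidiagonal.mem_antidiagonal.1 hp, prom_add]
    ring
  simp only [serVal, h]
  rw [← ENNReal.tsum_sigma, ← ENNReal.tsum_mul_right]
  simp only [← ENNReal.tsum_mul_left]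
  rw [← ENNReal.tsum_prod, ← Finset.HasAntidiagonal.sigmaAntidiagonalEquivProd.tsum_eq]
  rfl

theorem serVal_pow (f : Ser A) (k : ℕ) : serVal (f ^ k) x = serVal f x ^ k := by
  induction k with
  | zero => simp [serVal_one]
  | succ k ih => rw [pow_succ, pow_succ, serVal_mul, ih]

theorem serVal_prod (m : B →₀ ℕ) (s : B → Ser A) :
    serVal (m.prod fun a k => s a ^ k) x = prom (fun a => serVal (s a) x) m := by
  classical
  simp only [prom, Finsupp.prod]
  induction m.support using Finset.induction_on with
  | empty => simp [serVal_one]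
  | insert a S ha ih =>
    rw [Finset.prod_insert ha, Finset.prod_insert ha, serVal_mul, serVal_pow, ih]

theorem serVal_sum (f : J → Ser A) : serVal (serSum f) x = ∑' j, serVal (f j) x := by
  simp only [serVal, serSum, ← ENNReal.tsum_mul_right]
  rw [ENNReal.tsum_comm]

theorem serVal_app (t : (B →₀ ℕ) × C → Ser A) (s : B → Ser A) (c : C) :
    serVal (serApp t s c) x =
      matApp (fun p => serVal (t p) x) (prom fun b => serVal (s b) x) c := by
  simp only [serApp, serVal_sum, serVal_mul, serVal_prod, matApp]

theorem serVal_lam (t : C → Ser (B ⊕ A)) (v : B → ℝ≥0∞) (c : C) :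
    matApp (fun p => serVal (serLam t p) x) (prom v) c = serVal (t c) (Sum.elim v x) := by
  simp only [serVal, matApp, serLam, ← ENNReal.tsum_mul_right]
  rw [← ENNReal.tsum_prod, ← Finsupp.sumFinsuppEquivProdFinsupp.symm.tsum_eq]
  refine tsum_congr fun p => ?_
  have h : Finsupp.sumFinsuppEquivProdFinsupp.symm p = p.1.sumElim p.2 := rfl
  rw [h, mul_assoc, mul_comm (prom x p.2)]
  congr 1
  simp only [prom, Finsupp.prod_sumElim]
  rfl

theorem serVal_num (n k : ℕ) : serVal (serNum n k : Ser A) x = if k = n then 1 else 0 := by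
  unfold serNum
  split_ifs <;> simp [serVal_one, serVal_zero]

/-- Coefficientwise order. -/
def SerLe (f g : Ser A) : Prop := ∀ μ, f μ ≤ g μ

theorem SerLe.mul {f f' g g' : Ser A} (hf : SerLe f f') (hg : SerLe g g') :
    SerLe (f * g) (f' * g') := by
  classical
  intro μ
  have h1 : ∀ f g : Ser A, (f * g) μ = ∑ p ∈ Finset.HasAntidiagonal.antidiagonal μ, f p.1 * g p.2 :=
    fun f g => MvPowerSeries.coeff_mul μ f g
  rw [h1, h1]
  exact Finset.sum_le_sum fun p _ => mul_le_mul' (hf _) (hg _)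

theorem SerLe.pow {f g : Ser A} (h : SerLe f g) (k : ℕ) : SerLe (f ^ k) (g ^ k) := by
  induction k with
  | zero => rw [pow_zero, pow_zero]; exact fun _ => le_rfl
  | succ k ih => rw [pow_succ, pow_succ]; exact ih.mul h

theorem SerLe.prod {s s' : B → Ser A} (h : ∀ b, SerLe (s b) (s' b)) (m : B →₀ ℕ) :
    SerLe (m.prod fun a k => s a ^ k) (m.prod fun a k => s' a ^ k) := by
  classical
  simp only [Finsupp.prod]
  induction m.support using Finset.induction_on with
  | empty => intro μ; simp
  | insert a S ha ih =>
    rw [Finset.prod_insert ha, Finset.prod_insert ha]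
    exact ((h a).pow _).mul ih

theorem SerLe.app (t : (B →₀ ℕ) × C → Ser A) {s s' : B → Ser A}
    (h : ∀ b, SerLe (s b) (s' b)) (c : C) : SerLe (serApp t s c) (serApp t s' c) := by
  intro μ
  refine ENNReal.tsum_le_tsum fun m => ?_
  exact SerLe.mul (fun _ => le_rfl) (SerLe.prod h m) μ

theorem serFix_mono (t : (B →₀ ℕ) × B → Ser A) (n : ℕ) (b : B) :
    SerLe ((serApp t)^[n] (fun _ => 0) b) ((serApp t)^[n + 1] (fun _ => 0) b) := by
  induction n generalizing b with
  | zero => exact fun μ => zero_le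
  | succ n ih =>
    rw [Function.iterate_succ_apply', Function.iterate_succ_apply']
    exact SerLe.app t ih b

theorem serVal_fix (t : (B →₀ ℕ) × B → Ser A) (b : B) :
    serVal (serFix t b) x = ⨆ n : ℕ, serVal ((serApp t)^[n] (fun _ => 0) b) x := by
  simp only [serVal, serFix, ENNReal.iSup_mul]
  refine tsum_iSup_of_monotone _ (monotone_nat_of_le_succ fun n μ => ?_)
  exact mul_le_mul_left (serFix_mono t n b μ) _

end Val

theorem ser_mem {Γ : List Ty} {σ : Ty} (M : PTm Γ σ) (u : (ctxSem Γ).Web → ℝ≥0∞)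
    (hu : u ∈ (ctxSem Γ).P) : (fun a => serVal (ser M a) u) ∈ σ.sem.P := by
  induction M using Tm.rec with
  | var x =>
    simp only [ser, serVal_X]
    induction x with
    | zero => exact hu.1
    | succ x ih => exact ih _ hu.2
  | num n =>
    change ∑' k : ℕ, serVal (serNum n k) u ≤ 1
    simp [serVal_num]
  | succ M ih =>
    have ih : ∑' n : ℕ, serVal (ser M n) u ≤ 1 := ih u hu
    change ∑' k : ℕ, serVal (serSum fun n : ℕ => if k = n + 1 then ser M n else 0) u ≤ 1
    refine le_trans (le_of_eq ?_) ih
    simp only [serVal_sum]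
    rw [ENNReal.tsum_comm]
    simp only [apply_ite (fun f => serVal f u), serVal_zero, tsum_ite_eq]
  | pred M ih =>
    have ih : ∑' n : ℕ, serVal (ser M n) u ≤ 1 := ih u hu
    change ∑' k : ℕ, serVal (serSum fun n : ℕ => if k = n - 1 then ser M n else 0) u ≤ 1
    refine le_trans (le_of_eq ?_) ih
    simp only [serVal_sum]
    rw [ENNReal.tsum_comm]
    simp only [apply_ite (fun f => serVal f u), serVal_zero, tsum_ite_eq]
  | dice r =>
    change ∑' k : ℕ, serVal (ENNReal.ofReal r.1 • serNum 0 k +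
      ENNReal.ofReal (1 - r.1) • serNum 1 k) u ≤ 1
    simp only [serVal_add, serVal_smul, serVal_num, mul_ite, mul_one, mul_zero,
      ENNReal.tsum_add, tsum_ite_eq]
    rw [← ENNReal.ofReal_add (by exact_mod_cast r.2.1)
      (by rw [sub_nonneg]; exact_mod_cast r.2.2)]
    simp
  | letin M N ihM ihN =>
    have ihM : ∑' n : ℕ, serVal (ser M n) u ≤ 1 := ihM u hu
    simp only [ser, serVal_sum, serVal_mul]
    refine PCS.sum_mem _ ihM _ fun n => ?_
    refine PCS.mono (ihN (Sum.elim (fun k : ℕ => serVal (serNum n k) u) u) ⟨?_, hu⟩) fun c =>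
      le_of_eq ((serVal_app u _ _ c).trans (serVal_lam u (ser N) _ c))
    change ∑' k : ℕ, serVal (serNum n k) u ≤ 1
    simp [serVal_num]
  | ifz M N P ihM ihN ihP =>
    have ihM : ∑' n : ℕ, serVal (ser M n) u ≤ 1 := ihM u hu
    rw [tsum_eq_zero_add' ENNReal.summable] at ihM
    simp only [ser, serVal_add, serVal_mul, serVal_sum]
    exact PCS.add_mem ihM (ihN u hu) (ihP u hu)
  | app M N ihM ihN =>
    exact PCS.mono (matApp_prom_mem (ihM u hu) (ihN u hu)) fun c =>
      le_of_eq (serVal_app u (ser M) (ser N) c)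
  | lam M ih =>
    refine mem_lin_excl fun v hv => ?_
    have h := ih (Sum.elim v u) ⟨hv, hu⟩
    refine PCS.mono h fun c => le_of_eq ?_
    exact serVal_lam u (ser M) v c
  | fix M ih =>
    refine PCS.mono (PCS.iSup_mem
      (fun n a => serVal ((serApp (ser M))^[n] (fun _ => 0) a) u)
      (monotone_nat_of_le_succ fun n a => ?_) fun n => ?_) fun c =>
        le_of_eq (serVal_fix u (ser M) c)
    · exact ENNReal.tsum_le_tsum fun μ => mul_le_mul_left (serFix_mono (ser M) n a μ) _
    · induction n with
      | zero => simpa [serVal_zero] using PCS.zero_mem _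
      | succ n ihn =>
        simp only [Function.iterate_succ_apply']
        exact PCS.mono (matApp_prom_mem (ih u hu) ihn) fun c =>
          le_of_eq (serVal_app u (ser M) _ c)
  | mark _ l => exact l.elim

/-- The interpretation of a term of type `σ` in context `Γ` as a Kleisli morphism. -/
def sem {Γ : List Ty} {σ : Ty} (M : PTm Γ σ) : Kl (ctxSem Γ) σ.sem :=
  ⟨fun p => ser M p.2 p.1, mem_lin_excl fun x hx => ser_mem M x hx⟩

/-- The interpretation of a closed term as an element of `P`. -/
def semClosed {σ : Ty} (M : PTm [] σ) : σ.sem.P := (sem M).toFun ⟨Empty.elim, trivial⟩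

/-- The point `(r_i e_0)_i` of the interpretation of the context of `n` variables. -/
def basePoint : (n : ℕ) → (Fin n → unitInterval) → (ctxSem (natCtx n)).P
  | 0, _ => ⟨Empty.elim, trivial⟩
  | n + 1, r =>
    ⟨Sum.elim (fun k : ℕ => if k = 0 then ENNReal.ofReal (r 0) else 0)
      (basePoint n fun i => r i.succ).1, by
      refine ⟨?_, (basePoint n fun i => r i.succ).2⟩
      change ∑' k : ℕ, (if k = 0 then ENNReal.ofReal (r 0) else 0) ≤ 1
      rw [tsum_ite_eq]
      exact ENNReal.ofReal_le_one.2 (r 0).2.2⟩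

/-- The function `r ↦ ⟦spy M⟧((r_l e_0)_l)_0` from `[0,1]^L` to `[0,1]`, as a real number. -/
def spyFun {L : Type u} {n : ℕ} (e : L ≃ Fin n) (M : Tm L [] Ty.nat) (r : L → unitInterval) :
    ℝ :=
  (((sem (spyClosed e M)).toFun (basePoint n fun i => r (e.symm i))).1 (0 : ℕ)).toReal

/-- `D` is the partial derivative at `r`, in the coordinate `l`, of a function on `[0,1]^L`:
the limit in the extended reals of the difference quotients. -/
def HasPartialDeriv {L : Type u} [DecidableEq L] (f : (L → unitInterval) → ℝ) (l : L)
    (r : L → unitInterval) (D : EReal) : Prop :=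
  Filter.Tendsto
    (fun t : unitInterval =>
      (((f (Function.update r l t) - f r) / ((t : ℝ) - (r l : ℝ)) : ℝ) : EReal))
    (𝓝[≠] (r l)) (𝓝 D)

/-! ## Operational semantics -/

/-- `Stk L σ`: the stacks accepting a term of type `σ`. -/
inductive Stk (L : Type u) : Ty → Type u
  | nil : Stk L Ty.nat
  | arg {σ τ : Ty} : Tm L [] σ → Stk L τ → Stk L (Ty.arr σ τ)
  | succ : Stk L Ty.nat → Stk L Ty.nat
  | pred : Stk L Ty.nat → Stk L Ty.nat
  | ifz {σ : Ty} : Tm L [] σ → Tm L [] σ → Stk L σ → Stk L Ty.nat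
  | letin {σ : Ty} : Tm L [Ty.nat] σ → Stk L σ → Stk L Ty.nat

structure State (L : Type u) : Type u where
  {ty : Ty}
  tm : Tm L [] ty
  stk : Stk L ty

/-- The result of one step of the machine: a silent transition, a coin toss (to be resumed
by the result of the toss on the given stack), a label met in head position, termination, or
a state without transition. -/
inductive Outcome (L : Type u) : Type u
  | tau : State L → Outcome L
  | coin : Set.Icc (0 : ℚ) 1 → Stk L Ty.nat → Outcome L
  | tick : L → State L → Outcome L
  | halt : Outcome L
  | stuck : Outcome L

/-- The transitions of a state whose head is a numeral. -/
def stepNum {L : Type u} : ℕ → Stk L Ty.nat → Outcome L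
  | 0, .nil => .halt
  | _ + 1, .nil => .stuck
  | n, .succ π => .tau ⟨.num (n + 1), π⟩
  | n, .pred π => .tau ⟨.num (n - 1), π⟩
  | 0, .ifz N _ π => .tau ⟨N, π⟩
  | _ + 1, .ifz _ P π => .tau ⟨P, π⟩
  | n, .letin N π => .tau ⟨N.inst (.num n), π⟩

/-- The transitions of a state whose head is an abstraction. -/
def stepLam {L : Type u} {σ τ : Ty} (M : Tm L [σ] τ) : Stk L (Ty.arr σ τ) → Outcome L
  | .arg N π => .tau ⟨M.inst N, π⟩

def stepTm {L : Type u} : {σ : Ty} → Tm L [] σ → Stk L σ → Outcome L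
  | _, .num n, π => stepNum n π
  | _, .succ M, π => .tau ⟨M, .succ π⟩
  | _, .pred M, π => .tau ⟨M, .pred π⟩
  | _, .dice r, π => .coin r π
  | _, .letin M N, π => .tau ⟨M, .letin N π⟩
  | _, .ifz M N P, π => .tau ⟨M, .ifz N P π⟩
  | _, .app M N, π => .tau ⟨M, .arg N π⟩
  | _, .lam M, π => stepLam M π
  | _, .fix M, π => .tau ⟨M, .arg (.fix M) π⟩
  | _, .mark M l, π => .tick l ⟨M, π⟩

def step {L : Type u} (s : State L) : Outcome L := stepTm s.tm s.stk

/-- The sample space of finite sequences over `{0, 1}`. -/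
abbrev Cantor : Type := List (Fin 2)

instance : MeasurableSpace Cantor := ⊤

/-- The probability of the result `i` of a coin of parameter `r`: `0` with probability `r`. -/
def coinWeight (r : Set.Icc (0 : ℚ) 1) (i : Fin 2) : ℝ≥0∞ :=
  if i = 0 then ENNReal.ofReal r.1 else ENNReal.ofReal (1 - r.1)

/-- The graph of the partial evaluation function of unlabeled states: `Eval s α p` holds when
the run of `s` along `α` terminates, consuming `α` exactly, with probability `p`. -/
inductive Eval : State Empty → Cantor → ℝ≥0∞ → Prop
  | halt {s : State Empty} : step s = .halt → Eval s [] 1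
  | tau {s s' : State Empty} {α : Cantor} {p : ℝ≥0∞} :
      step s = .tau s' → Eval s' α p → Eval s α p
  | coin {s : State Empty} {r : Set.Icc (0 : ℚ) 1} {π : Stk Empty Ty.nat} {i : Fin 2}
      {α : Cantor} {p : ℝ≥0∞} :
      step s = .coin r π → Eval ⟨.num i, π⟩ α p → Eval s (i :: α) (p * coinWeight r i)

/-- The graph of the partial evaluation function of labeled states: `EvalTick s α μ` holds
when the run of `s` along `α` terminates, consuming `α` exactly, and `μ` is the multiset of
the labels met in head position. -/
inductive EvalTick {L : Type u} : State L → Cantor → (L →₀ ℕ) → Prop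
  | halt {s : State L} : step s = .halt → EvalTick s [] 0
  | tau {s s' : State L} {α : Cantor} {μ : L →₀ ℕ} :
      step s = .tau s' → EvalTick s' α μ → EvalTick s α μ
  | coin {s : State L} {r : Set.Icc (0 : ℚ) 1} {π : Stk L Ty.nat} {i : Fin 2}
      {α : Cantor} {μ : L →₀ ℕ} :
      step s = .coin r π → EvalTick ⟨.num i, π⟩ α μ → EvalTick s (i :: α) μ
  | tick {s s' : State L} {l : L} {α : Cantor} {μ : L →₀ ℕ} :
      step s = .tick l s' → EvalTick s' α μ → EvalTick s α (μ + Finsupp.single l 1)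

theorem Eval.unique {s : State Empty} {α : Cantor} {p q : ℝ≥0∞} (hp : Eval s α p)
    (hq : Eval s α q) : p = q := by
  induction hp generalizing q with
  | halt h => cases hq <;> simp_all
  | tau h _ ih =>
    cases hq with
    | halt h' => simp_all
    | tau h' k =>
      rw [h] at h'
      cases h'
      exact ih k
    | coin h' _ => simp_all
  | coin h _ ih =>
    cases hq with
    | tau h' _ => simp_all
    | coin h' k =>
      rw [h] at h'
      cases h'
      rw [ih k]

theorem EvalTick.unique {L : Type u} {s : State L} {α : Cantor} {μ ν : L →₀ ℕ}
    (hp : EvalTick s α μ) (hq : EvalTick s α ν) : μ = ν := by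
  induction hp generalizing ν with
  | halt h => cases hq <;> simp_all
  | tau h _ ih =>
    cases hq with
    | halt h' => simp_all
    | tau h' k =>
      rw [h] at h'
      cases h'
      exact ih k
    | coin h' _ => simp_all
    | tick h' _ => simp_all
  | coin h _ ih =>
    cases hq with
    | tau h' _ => simp_all
    | coin h' k =>
      rw [h] at h'
      cases h'
      rw [ih k]
    | tick h' _ => simp_all
  | tick h _ ih =>
    cases hq with
    | halt h' => simp_all
    | tau h' _ => simp_all
    | coin h' _ => simp_all
    | tick h' k =>
      rw [h] at h'
      cases h'
      rw [ih k]

/-- The domain of the evaluation function of `s`. -/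
def evalDom (s : State Empty) : Set Cantor := {α | ∃ p, Eval s α p}

open Classical in
/-- The evaluation function of unlabeled states, extended by `0` outside of its domain. -/
def evalProb (s : State Empty) (α : Cantor) : ℝ≥0∞ :=
  if h : ∃ p, Eval s α p then h.choose else 0

open Classical in
/-- The evaluation function of labeled states, extended by `0` outside of its domain. -/
def evalLabels {L : Type u} (s : State L) (α : Cantor) : L →₀ ℕ :=
  if h : ∃ μ, EvalTick s α μ then h.choose else 0

theorem evalProb_eq {s : State Empty} {α : Cantor} {p : ℝ≥0∞} (h : Eval s α p) :
    evalProb s α = p := by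
  have h' : ∃ p, Eval s α p := ⟨p, h⟩
  rw [evalProb, dif_pos h']
  exact h'.choose_spec.unique h

theorem evalLabels_eq {L : Type u} {s : State L} {α : Cantor} {μ : L →₀ ℕ}
    (h : EvalTick s α μ) : evalLabels s α = μ := by
  have h' : ∃ μ, EvalTick s α μ := ⟨μ, h⟩
  rw [evalLabels, dif_pos h']
  exact h'.choose_spec.unique h

theorem tsum_cantor (f : Cantor → ℝ≥0∞) :
    ∑' α, f α = f [] + (∑' α, f (0 :: α) + ∑' α, f (1 :: α)) := by
  let e : Unit ⊕ (Cantor ⊕ Cantor) ≃ Cantor :=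
    { toFun := Sum.elim (fun _ => []) (Sum.elim (fun α => 0 :: α) fun α => 1 :: α)
      invFun := fun α => match α with
        | [] => Sum.inl ()
        | i :: α => if i = 0 then Sum.inr (Sum.inl α) else Sum.inr (Sum.inr α)
      left_inv := by rintro (_ | _ | _) <;> simp
      right_inv := by
        rintro (_ | ⟨i, α⟩)
        · rfl
        · fin_cases i <;> simp }
  rw [← e.tsum_eq, ENNReal.summable.tsum_sum ENNReal.summable,
    ENNReal.summable.tsum_sum ENNReal.summable]
  simp [e]

/-- Evaluation bounded by a number of steps. -/
def evalFuel : ℕ → State Empty → Cantor → ℝ≥0∞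
  | 0, _, _ => 0
  | n + 1, s, α =>
    match step s, α with
    | .halt, [] => 1
    | .tau s', α => evalFuel n s' α
    | .coin r π, i :: α => evalFuel n ⟨.num i, π⟩ α * coinWeight r i
    | _, _ => 0

theorem evalFuel_mono (n : ℕ) (s : State Empty) (α : Cantor) :
    evalFuel n s α ≤ evalFuel (n + 1) s α := by
  induction n generalizing s α with
  | zero => exact zero_le
  | succ n ih =>
    cases h : step s with
    | halt => cases α <;> simp [evalFuel, h]
    | tau s' =>
      have e : ∀ k, evalFuel (k + 1) s α = evalFuel k s' α := fun k => by
        simp only [evalFuel, h]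
      rw [e, e]
      exact ih _ _
    | coin r π =>
      cases α with
      | nil => simp [evalFuel, h]
      | cons i α =>
        have e : ∀ k, evalFuel (k + 1) s (i :: α) =
            evalFuel k ⟨.num i, π⟩ α * coinWeight r i := fun k => by
          simp only [evalFuel, h]
        rw [e, e]
        exact mul_le_mul_left (ih _ _) _
    | tick l _ => exact l.elim
    | stuck => simp [evalFuel, h]

theorem evalFuel_tsum_le (n : ℕ) (s : State Empty) : ∑' α, evalFuel n s α ≤ 1 := by
  induction n generalizing s with
  | zero => simp [evalFuel]
  | succ n ih =>
    cases h : step s with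
    | halt =>
      rw [tsum_cantor]
      simp [evalFuel, h]
    | tau s' =>
      simp only [evalFuel, h]
      exact ih s'
    | coin r π =>
      rw [tsum_cantor]
      simp only [evalFuel, h, ENNReal.tsum_mul_right, zero_add]
      have h1 : coinWeight r 0 + coinWeight r 1 = 1 := by
        unfold coinWeight
        rw [if_pos rfl, if_neg (by decide), ← ENNReal.ofReal_add (by exact_mod_cast r.2.1)
          (by rw [sub_nonneg]; exact_mod_cast r.2.2)]
        simp
      rw [← h1]
      exact add_le_add ((mul_le_mul_left (ih _) _).trans_eq (one_mul _))
        ((mul_le_mul_left (ih _) _).trans_eq (one_mul _))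
    | tick l _ => exact l.elim
    | stuck => simp [evalFuel, h]

theorem Eval.exists_fuel {s : State Empty} {α : Cantor} {p : ℝ≥0∞} (h : Eval s α p) :
    ∃ n, evalFuel n s α = p := by
  induction h with
  | halt h => exact ⟨1, by simp [evalFuel, h]⟩
  | tau h _ ih =>
    obtain ⟨n, hn⟩ := ih
    exact ⟨n + 1, by simp [evalFuel, h, hn]⟩
  | coin h _ ih =>
    obtain ⟨n, hn⟩ := ih
    exact ⟨n + 1, by simp [evalFuel, h, hn]⟩

theorem evalProb_tsum_le (s : State Empty) : ∑' α, evalProb s α ≤ 1 := by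
  calc ∑' α, evalProb s α ≤ ∑' α, ⨆ n, evalFuel n s α := by
        refine ENNReal.tsum_le_tsum fun α => ?_
        by_cases h : ∃ p, Eval s α p
        · obtain ⟨p, hp⟩ := h
          obtain ⟨n, hn⟩ := hp.exists_fuel
          rw [evalProb_eq hp, ← hn]
          exact le_iSup (fun n => evalFuel n s α) n
        · simp [evalProb, h]
    _ = ⨆ n, ∑' α, evalFuel n s α :=
        tsum_iSup_of_monotone _ (monotone_nat_of_le_succ fun n α => evalFuel_mono n s α)
    _ ≤ 1 := iSup_le fun n => evalFuel_tsum_le n s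

/-- The total probability density associated with `s`: the missing mass is put on the
sequence `[1]`. -/
def density (s : State Empty) : Cantor → ℝ≥0∞
  | 0 :: β => evalProb s β
  | [1] => 1 - ∑' β, evalProb s β
  | _ => 0

theorem density_tsum (s : State Empty) : ∑' α, density s α = 1 := by
  rw [tsum_cantor]
  have h1 : ∀ α, density s (1 :: α) = if α = [] then 1 - ∑' β, evalProb s β else 0 := by
    intro α
    cases α <;> simp [density]
  simp only [h1, tsum_ite_eq]
  simp only [density, zero_add]
  exact add_tsub_cancel_of_le (evalProb_tsum_le s)

/-- The probability measure on the sample space associated with `s`. -/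
def proba (s : State Empty) : MeasureTheory.Measure Cantor :=
  PMF.toMeasure ⟨density s, by
    have h := ENNReal.summable.hasSum (f := density s)
    rwa [density_tsum] at h⟩

/-- The event that the evaluation of `s` converges (to `0`). -/
def converges (s : State Empty) : Set Cantor := {α | ∃ β ∈ evalDom s, α = 0 :: β}

/-- The random multiset of the labels met in head position. -/
def labelCount {L : Type u} (s : State L) : Cantor → L →₀ ℕ
  | 0 :: β => evalLabels s β
  | _ => 0

def Stk.strip {L : Type u} : {σ : Ty} → Stk L σ → Stk Empty σ
  | _, .nil => .nil
  | _, .arg N π => .arg N.strip π.strip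
  | _, .succ π => .succ π.strip
  | _, .pred π => .pred π.strip
  | _, .ifz N P π => .ifz N.strip P.strip π.strip
  | _, .letin N π => .letin N.strip π.strip

def State.strip {L : Type u} (s : State L) : State Empty := ⟨s.tm.strip, s.stk.strip⟩

/-- The initial state of a closed term of type `nat`. -/
def start {L : Type u} (M : Tm L [] Ty.nat) : State L := ⟨M, .nil⟩

/-- The conditional expectation of the number of occurrences of `l`-labeled subterms
arriving in head position in the evaluation of `s`, given that this evaluation converges. -/
def condMeanCount {L : Type u} (s : State L) (l : L) : ℝ≥0∞ :=
  ∫⁻ α, (labelCount s α l : ℝ≥0∞)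
    ∂(ProbabilityTheory.cond (proba s.strip) (converges s.strip))

end PPCF

end

/-! The function `f` is a generating function, and the theorem is the rule that a mean is the
derivative of the generating function at `1`. Let `p β` be the probability of the run of the
stripped state along `β`, and `k_l β` the number of times `l` is met in the run of `s` along `β`.
The heart of the proof is the identity `f(r) = ∑ β, p β * ∏ l, r_l ^ k_l β`.

To obtain it, the labeled machine itself is weighted: meeting `l` in head position multiplies the
weight of the run by `r_l`. On the denotational side the spy construct `if(x_l, M, Ω)`, evaluated at
`x_l = r_l e_0`, is the scalar multiple `r_l ⟦M⟧`. Adequacy can thus be proved directly between `⟦sp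
M⟧` and weighted labeled runs (`value_spy_eq_totalWeight`), and the spy term is never executed.

Adequacy is two inequalities, each given by a logical relation between vectors and closed terms. The
vectors of `Below` bound the weight from below; this relation is closed under suprema, so it handles
`fix` through its iterates. Upper bounds need not pass from the iterates to their supremum in this
way. `Above` is therefore indexed by a number of machine steps, and `fix` is handled through the
fixed point equation, each unfolding costing a step. Both relations are instances of `TermRel`, for
which the fundamental lemma `TermRel.spy` is proved once.

With all labels but `l` weighted `1`, `f` becomes `t ↦ ∑ β, p β * t ^ k β`. Its difference quotient
at `1` is `∑ β, p β * (1 + t + ⋯ + t ^ (k β - 1))`, which tends to `∑ β, p β * k β`, finite or not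
(`tendsto_slope`). This sum divided by `∑ β, p β` is the conditional expectation
(`condMeanCount_eq`), and `∑ β, p β` is `⟦strip M⟧_0` by adequacy without labels
(`semClosed_strip`). -/

namespace PPCF

/-! ## Substitution -/

section Substitution

variable {L : Type u}

theorem Ren.lift_comp {Γ Δ Θ : List Ty} (ρ : Ren Γ Δ) (ρ' : Ren Δ Θ) (τ : Ty) :
    (fun σ y => ρ'.lift τ σ (ρ.lift τ σ y)) = Ren.lift (fun σ y => ρ' σ (ρ σ y)) τ := by
  funext σ y
  cases y <;> rfl

/-- `Sub.lift` renames the values of a substitution, so `Tm.subst_subst` can cross a binder only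
once the mixed laws are known, and `Tm.rename_subst` in turn rests on this one. -/
theorem Tm.rename_rename {Γ Δ Θ : List Ty} {σ : Ty} (M : Tm L Γ σ) (ρ : Ren Γ Δ)
    (ρ' : Ren Δ Θ) : (M.rename ρ).rename ρ' = M.rename fun σ y => ρ' σ (ρ σ y) := by
  induction M generalizing Δ Θ <;> simp_all [Tm.rename, Ren.lift_comp]

theorem Sub.lift_comp_ren {Γ Δ Θ : List Ty} (ρ : Ren Γ Δ) (θ : Sub L Δ Θ) (τ : Ty) :
    (fun σ y => θ.lift τ σ (ρ.lift τ σ y)) = Sub.lift (fun σ y => θ σ (ρ σ y)) τ := by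
  funext σ y
  cases y <;> rfl

theorem Tm.subst_rename {Γ Δ Θ : List Ty} {σ : Ty} (M : Tm L Γ σ) (ρ : Ren Γ Δ)
    (θ : Sub L Δ Θ) : (M.rename ρ).subst θ = M.subst fun σ y => θ σ (ρ σ y) := by
  induction M generalizing Δ Θ <;> simp_all [Tm.rename, Tm.subst, Sub.lift_comp_ren]

theorem Sub.rename_lift {Γ Δ Θ : List Ty} (θ : Sub L Γ Δ) (ρ : Ren Δ Θ) (τ : Ty) :
    (fun σ y => (θ.lift τ σ y).rename (ρ.lift τ)) =
      Sub.lift (fun σ y => (θ σ y).rename ρ) τ := by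
  funext σ y
  cases y with
  | zero => rfl
  | succ y =>
    exact (Tm.rename_rename _ _ _).trans (Tm.rename_rename (θ _ y) ρ fun _ z => .succ z).symm

theorem Tm.rename_subst {Γ Δ Θ : List Ty} {σ : Ty} (M : Tm L Γ σ) (θ : Sub L Γ Δ)
    (ρ : Ren Δ Θ) : (M.subst θ).rename ρ = M.subst fun σ y => (θ σ y).rename ρ := by
  induction M generalizing Δ Θ <;> simp_all [Tm.rename, Tm.subst, Sub.rename_lift]

theorem Sub.subst_lift {Γ Δ Θ : List Ty} (θ : Sub L Γ Δ) (θ' : Sub L Δ Θ) (τ : Ty) :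
    (fun σ y => (θ.lift τ σ y).subst (θ'.lift τ)) =
      Sub.lift (fun σ y => (θ σ y).subst θ') τ := by
  funext σ y
  cases y with
  | zero => rfl
  | succ y => exact (Tm.subst_rename _ _ _).trans (Tm.rename_subst _ _ _).symm

theorem Tm.subst_subst {Γ Δ Θ : List Ty} {σ : Ty} (M : Tm L Γ σ) (θ : Sub L Γ Δ)
    (θ' : Sub L Δ Θ) : (M.subst θ).subst θ' = M.subst fun σ y => (θ σ y).subst θ' := by
  induction M generalizing Δ Θ <;> simp_all [Tm.subst, Sub.subst_lift]

theorem Sub.lift_var (Γ : List Ty) (τ : Ty) :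
    Sub.lift (fun _ y => Tm.var y : Sub L Γ Γ) τ = fun _ y => Tm.var y := by
  funext σ y
  cases y <;> rfl

theorem Tm.subst_var {Γ : List Ty} {σ : Ty} (M : Tm L Γ σ) :
    M.subst (fun _ y => Tm.var y) = M := by
  induction M <;> simp_all [Tm.subst, Sub.lift_var]

/-- Extension of a substitution by a term. -/
def Sub.cons {Γ Δ : List Ty} {τ : Ty} (N : Tm L Δ τ) (θ : Sub L Γ Δ) : Sub L (τ :: Γ) Δ
  | _, .zero => N
  | _, .succ y => θ _ y

/-- In the fundamental lemma the machine instantiates the body of a `lam` or `letin` already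
substituted by `θ`; this turns the result into one extended environment, to which the induction
hypothesis applies. -/
theorem Tm.inst_subst_lift {Γ Δ : List Ty} {σ τ : Ty} (M : Tm L (τ :: Γ) σ) (θ : Sub L Γ Δ)
    (N : Tm L Δ τ) : (M.subst (θ.lift τ)).inst N = M.subst (Sub.cons N θ) := by
  rw [Tm.inst, Tm.subst_subst]
  congr 1
  funext σ y
  cases y with
  | zero => rfl
  | succ y => exact (Tm.subst_rename _ _ _).trans (θ _ y).subst_var

theorem Tm.subst_closed {σ : Ty} (M : Tm L [] σ) (θ : Sub L [] []) : M.subst θ = M := by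
  have h : θ = fun _ y => Tm.var y := by
    funext σ y
    cases y
  rw [h, M.subst_var]

/-! ### Removal of labels under renaming and substitution -/

theorem Tm.strip_rename {Γ Δ : List Ty} {σ : Ty} (M : Tm L Γ σ) (ρ : Ren Γ Δ) :
    (M.rename ρ).strip = M.strip.rename ρ := by
  induction M generalizing Δ <;> simp_all [Tm.rename, Tm.strip]

theorem Sub.strip_lift {Γ Δ : List Ty} (θ : Sub L Γ Δ) (τ : Ty) :
    (fun σ y => (θ.lift τ σ y).strip) = Sub.lift (fun σ y => (θ σ y).strip) τ := by
  funext σ y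
  cases y with
  | zero => rfl
  | succ y => exact Tm.strip_rename _ _

theorem Tm.strip_subst {Γ Δ : List Ty} {σ : Ty} (M : Tm L Γ σ) (θ : Sub L Γ Δ) :
    (M.subst θ).strip = M.strip.subst fun σ y => (θ σ y).strip := by
  induction M generalizing Δ <;> simp_all [Tm.subst, Tm.strip, Sub.strip_lift]

theorem Tm.strip_inst {Γ : List Ty} {σ τ : Ty} (M : Tm L (τ :: Γ) σ) (N : Tm L Γ τ) :
    (M.inst N).strip = M.strip.inst N.strip := by
  rw [Tm.inst, Tm.inst, Tm.strip_subst]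
  congr 1
  funext σ y
  cases y <;> rfl

theorem Tm.strip_of_isEmpty {Γ : List Ty} {σ : Ty} (M : PTm Γ σ) : M.strip = M := by
  induction M with
  | mark _ l => exact l.elim
  | _ => simp_all [Tm.strip]

theorem Ren.lift_id (Γ : List Ty) (τ : Ty) :
    Ren.lift (fun _ y => y : Ren Γ Γ) τ = fun _ y => y := by
  funext σ y
  cases y <;> rfl

theorem Tm.spy_of_isEmpty {Γ : List Ty} {σ : Ty} (M : PTm Γ σ)
    (x : Empty → Var Γ Ty.nat) : M.spy (fun _ y => y) x = M := by
  induction M with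
  | mark _ l => exact l.elim
  | _ => simp_all [Tm.spy, Ren.lift_id]

end Substitution

/-! ## Weighted runs -/

section Operational

variable {L : Type u} (r : L → ℝ≥0∞)

/-- The probability that `s` runs along `α` to convergence within `n` steps, multiplied by `r l`
for each occurrence of a label `l` in head position. -/
noncomputable def pathWeight : ℕ → State L → Cantor → ℝ≥0∞
  | 0, _, _ => 0
  | n + 1, s, α =>
    match step s, α with
    | .halt, [] => 1
    | .tau s', α => pathWeight n s' α
    | .coin q π, i :: α => coinWeight q i * pathWeight n ⟨.num i, π⟩ α
    | .tick l s', α => r l * pathWeight n s' α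
    | _, _ => 0

/-- The total weight of the convergent runs of at most `n` steps. -/
noncomputable def runWeight (n : ℕ) (s : State L) : ℝ≥0∞ := ∑' α, pathWeight r n s α

/-- The total weight of the convergent runs. -/
noncomputable def totalWeight (s : State L) : ℝ≥0∞ := ⨆ n, runWeight r n s

theorem runWeight_zero (s : State L) : runWeight r 0 s = 0 := by
  simp [runWeight, pathWeight]

theorem runWeight_halt {s : State L} (h : step s = .halt) (n : ℕ) :
    runWeight r (n + 1) s = 1 := by
  rw [runWeight, tsum_cantor]
  simp [pathWeight, h]

theorem runWeight_stuck {s : State L} (h : step s = .stuck) (n : ℕ) :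
    runWeight r n s = 0 := by
  cases n <;> simp [runWeight, pathWeight, h]

theorem runWeight_tau {s s' : State L} (h : step s = .tau s') (n : ℕ) :
    runWeight r (n + 1) s = runWeight r n s' := by
  simp [runWeight, pathWeight, h]

theorem runWeight_coin {s : State L} {q : Set.Icc (0 : ℚ) 1} {π : Stk L Ty.nat}
    (h : step s = .coin q π) (n : ℕ) :
    runWeight r (n + 1) s =
      coinWeight q 0 * runWeight r n ⟨.num 0, π⟩ + coinWeight q 1 * runWeight r n ⟨.num 1, π⟩ := by
  rw [runWeight, tsum_cantor]
  simp [pathWeight, h, runWeight, ENNReal.tsum_mul_left]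

theorem runWeight_tick {s s' : State L} {l : L} (h : step s = .tick l s') (n : ℕ) :
    runWeight r (n + 1) s = r l * runWeight r n s' := by
  simp [runWeight, pathWeight, h, ENNReal.tsum_mul_left]

theorem pathWeight_mono (s : State L) (α : Cantor) : Monotone fun n => pathWeight r n s α := by
  refine monotone_nat_of_le_succ fun n => ?_
  induction n generalizing s α with
  | zero => exact zero_le
  | succ n ih =>
    cases h : step s with
    | halt => cases α <;> simp [pathWeight, h]
    | tau s' => simpa only [pathWeight, h] using ih _ _
    | coin q π =>
      cases α with
      | nil => simp [pathWeight, h]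
      | cons i α => simpa only [pathWeight, h] using mul_le_mul_right (ih _ _) _
    | tick l s' => simpa only [pathWeight, h] using mul_le_mul_right (ih _ _) _
    | stuck => simp [pathWeight, h]

theorem runWeight_mono (s : State L) : Monotone fun n => runWeight r n s :=
  fun _ _ h => ENNReal.tsum_le_tsum fun α => pathWeight_mono r s α h

theorem totalWeight_eq_iSup_succ (s : State L) :
    totalWeight r s = ⨆ n, runWeight r (n + 1) s :=
  ((runWeight_mono r s).iSup_nat_add 1).symm

theorem totalWeight_halt {s : State L} (h : step s = .halt) : totalWeight r s = 1 := by
  simp [totalWeight_eq_iSup_succ, runWeight_halt r h]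

theorem totalWeight_stuck {s : State L} (h : step s = .stuck) : totalWeight r s = 0 := by
  simp [totalWeight, runWeight_stuck r h]

theorem totalWeight_tau {s s' : State L} (h : step s = .tau s') :
    totalWeight r s = totalWeight r s' := by
  rw [totalWeight_eq_iSup_succ]
  simp only [runWeight_tau r h, totalWeight]

theorem totalWeight_coin {s : State L} {q : Set.Icc (0 : ℚ) 1} {π : Stk L Ty.nat}
    (h : step s = .coin q π) :
    totalWeight r s =
      coinWeight q 0 * totalWeight r ⟨.num 0, π⟩ + coinWeight q 1 * totalWeight r ⟨.num 1, π⟩ := by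
  rw [totalWeight_eq_iSup_succ]
  simp only [runWeight_coin r h, totalWeight, ENNReal.mul_iSup]
  exact (ENNReal.iSup_add_iSup_of_monotone
    (fun _ _ h => mul_le_mul_right (runWeight_mono r _ h) _)
    (fun _ _ h => mul_le_mul_right (runWeight_mono r _ h) _)).symm

theorem totalWeight_tick {s s' : State L} {l : L} (h : step s = .tick l s') :
    totalWeight r s = r l * totalWeight r s' := by
  rw [totalWeight_eq_iSup_succ]
  simp only [runWeight_tick r h, totalWeight, ENNReal.mul_iSup]

/-- Removal of the labels in the result of a step that does not meet a label. -/
def Outcome.strip : Outcome L → Outcome Empty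
  | .tau s => .tau s.strip
  | .coin q π => .coin q π.strip
  | .tick _ s => .tau s.strip
  | .halt => .halt
  | .stuck => .stuck

/-! ### Labeled runs compared with runs of the stripped state -/

theorem stepNum_strip (n : ℕ) (π : Stk L Ty.nat) :
    stepNum n π.strip = (stepNum n π).strip := by
  cases π <;> cases n <;>
    simp [stepNum, Stk.strip, Outcome.strip, State.strip, Tm.strip, Tm.strip_inst]

theorem step_strip {s : State L} (h : ∀ l s', step s ≠ .tick l s') :
    step s.strip = (step s).strip := by
  obtain ⟨M, π⟩ := s
  cases M with
  | var y => cases y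
  | num n => exact stepNum_strip n π
  | lam M =>
    cases π with
    | arg N π => simp [step, stepTm, stepLam, Stk.strip, Outcome.strip, State.strip, Tm.strip,
        Tm.strip_inst]
  | mark M l => exact absurd rfl (h l ⟨M, π⟩)
  | _ => rfl

theorem strip_of_tick {s s' : State L} {l : L} (h : step s = .tick l s') :
    s.strip = s'.strip := by
  obtain ⟨M, π⟩ := s
  cases M with
  | var y => cases y
  | num n => cases π <;> cases n <;> cases h
  | lam M => cases π; cases h
  | mark M l => cases h; rfl
  | _ => cases h

/-- The monomial `∏ l, r l ^ μ l`. -/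
noncomputable def labelWeight (μ : L →₀ ℕ) : ℝ≥0∞ := μ.prod fun l k => r l ^ k

theorem labelWeight_add_single (μ : L →₀ ℕ) (l : L) :
    labelWeight r (μ + Finsupp.single l 1) = r l * labelWeight r μ := by
  classical
  rw [labelWeight, Finsupp.prod_add_index' (fun _ => pow_zero _) fun _ _ _ => pow_add _ _ _]
  simp [labelWeight, mul_comm]

theorem EvalTick.exists_eval {s : State L} {α : Cantor} {μ : L →₀ ℕ} (h : EvalTick s α μ) :
    ∃ p, Eval s.strip α p ∧ ∃ n, pathWeight r n s α = p * labelWeight r μ := by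
  induction h with
  | halt h =>
    refine ⟨1, .halt ?_, 1, by simp [pathWeight, h, labelWeight]⟩
    rw [step_strip (by simp [h]), h, Outcome.strip]
  | tau h _ ih =>
    obtain ⟨p, hp, n, hn⟩ := ih
    refine ⟨p, .tau ?_ hp, n + 1, by simp [pathWeight, h, hn]⟩
    rw [step_strip (by simp [h]), h, Outcome.strip]
  | coin h _ ih =>
    obtain ⟨p, hp, n, hn⟩ := ih
    refine ⟨_, .coin ?_ hp, n + 1, by simp only [pathWeight, h, hn]; ring⟩
    rw [step_strip (by simp [h]), h, Outcome.strip]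
  | tick h _ ih =>
    obtain ⟨p, hp, n, hn⟩ := ih
    refine ⟨p, by rwa [strip_of_tick h], n + 1, ?_⟩
    simp only [pathWeight, h, hn, labelWeight_add_single]
    ring

/-- Converse of `EvalTick.exists_eval`: a fuel bound either cuts the run along `α` off, giving `0`,
or already yields its full weight. Together they determine the supremum over `n` for each `α`. -/
theorem pathWeight_eq_zero_or (n : ℕ) (s : State L) (α : Cantor) :
    pathWeight r n s α = 0 ∨ ∃ μ p, EvalTick s α μ ∧ Eval s.strip α p ∧
      pathWeight r n s α = p * labelWeight r μ := by
  induction n generalizing s α with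
  | zero => exact Or.inl rfl
  | succ n ih =>
    cases h : step s with
    | halt =>
      cases α with
      | nil =>
        refine Or.inr ⟨0, 1, .halt h, .halt ?_, by simp [pathWeight, h, labelWeight]⟩
        rw [step_strip (by simp [h]), h, Outcome.strip]
      | cons i α => simp [pathWeight, h]
    | tau s' =>
      simp only [pathWeight, h]
      refine (ih s' α).imp id fun ⟨μ, p, hμ, hp, e⟩ => ⟨μ, p, .tau h hμ, .tau ?_ hp, e⟩
      rw [step_strip (by simp [h]), h, Outcome.strip]
    | coin q π =>
      cases α with
      | nil => simp [pathWeight, h]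
      | cons i α =>
        simp only [pathWeight, h]
        refine (ih ⟨.num i, π⟩ α).imp (fun e => by rw [e, mul_zero]) fun ⟨μ, p, hμ, hp, e⟩ =>
          ⟨μ, _, .coin h hμ, .coin ?_ hp, by rw [e]; ring⟩
        rw [step_strip (by simp [h]), h, Outcome.strip]
    | tick l s' =>
      simp only [pathWeight, h]
      refine (ih s' α).imp (fun e => by rw [e, mul_zero]) fun ⟨μ, p, hμ, hp, e⟩ =>
        ⟨_, p, .tick h hμ, by rwa [strip_of_tick h], ?_⟩
      rw [e, labelWeight_add_single]
      ring
    | stuck => simp [pathWeight, h]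

theorem sizeOf_lt_of_tick {s s' : State L} {l : L} (h : step s = .tick l s') :
    sizeOf s'.tm < sizeOf s.tm := by
  obtain ⟨M, π⟩ := s
  cases M with
  | var y => cases y
  | num n => cases π <;> cases n <;> cases h
  | lam M => cases π; cases h
  | mark M l =>
    cases h
    simp only [Tm.mark.sizeOf_spec]
    omega
  | _ => cases h

/-- Each state reaches by label transitions a state whose head is not labeled. -/
theorem exists_not_tick (s : State L) :
    ∃ s' : State L, s'.strip = s.strip ∧ (∀ l t, step s' ≠ .tick l t) ∧
      ∀ α μ, EvalTick s' α μ → ∃ ν, EvalTick s α ν := by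
  by_cases hs : ∃ l t, step s = .tick l t
  · obtain ⟨l, t, h⟩ := hs
    have := sizeOf_lt_of_tick h
    obtain ⟨s', h1, h2, h3⟩ := exists_not_tick t
    refine ⟨s', h1.trans (strip_of_tick h).symm, h2, fun α μ hμ => ?_⟩
    obtain ⟨ν, hν⟩ := h3 α μ hμ
    exact ⟨_, .tick h hν⟩
  · exact ⟨s, rfl, fun l t h => hs ⟨l, t, h⟩, fun _ μ h => ⟨μ, h⟩⟩
termination_by sizeOf s.tm

/-- The stripped machine stands still while labels are met, so each of its steps is lifted after
peeling off the labels at the head. There are finitely many of them, since each one shrinks the head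
term. -/
theorem Eval.exists_evalTick {t : State Empty} {α : Cantor} {p : ℝ≥0∞} (h : Eval t α p)
    (s : State L) (hs : s.strip = t) : ∃ μ, EvalTick s α μ := by
  induction h generalizing s with
  | halt h =>
    obtain ⟨s', h1, h2, h3⟩ := exists_not_tick s
    rw [← hs, ← h1, step_strip h2] at h
    cases h' : step s' <;> rw [h'] at h <;> cases h
    exact h3 _ _ (.halt h')
  | tau h _ ih =>
    obtain ⟨s', h1, h2, h3⟩ := exists_not_tick s
    rw [← hs, ← h1, step_strip h2] at h
    cases h' : step s' <;> rw [h'] at h <;> cases h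
    · obtain ⟨μ, hμ⟩ := ih _ rfl
      exact h3 _ _ (.tau h' hμ)
    -- `Outcome.strip` makes label transitions silent too, which is why this case appears; the
    -- peeled state has none.
    · exact absurd h' (h2 _ _)
  | @coin _ _ _ i _ _ h _ ih =>
    obtain ⟨s', h1, h2, h3⟩ := exists_not_tick s
    rw [← hs, ← h1, step_strip h2] at h
    cases h' : step s' with
    | coin q π =>
      rw [h'] at h
      cases h
      obtain ⟨μ, hμ⟩ := ih ⟨.num i, π⟩ rfl
      exact h3 _ _ (.coin h' hμ)
    | _ => rw [h'] at h; cases h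

/-- The total weight of the convergent runs of a labeled state, in terms of its evaluation
functions. -/
theorem totalWeight_eq_tsum (s : State L) :
    totalWeight r s = ∑' α, evalProb s.strip α * labelWeight r (evalLabels s α) := by
  rw [totalWeight]
  simp only [runWeight]
  rw [← tsum_iSup_of_monotone _ fun _ _ h α => pathWeight_mono r s α h]
  refine tsum_congr fun α => le_antisymm (iSup_le fun n => ?_) ?_
  · change pathWeight r n s α ≤ _
    obtain h | ⟨μ, p, hμ, hp, h⟩ := pathWeight_eq_zero_or r n s α
    · rw [h]
      exact zero_le
    · rw [h, evalProb_eq hp, evalLabels_eq hμ]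
  · by_cases h : ∃ p, Eval s.strip α p
    · obtain ⟨p, hp⟩ := h
      obtain ⟨μ, hμ⟩ := hp.exists_evalTick s rfl
      obtain ⟨q, hq, n, hn⟩ := hμ.exists_eval r
      rw [evalProb_eq hq, evalLabels_eq hμ, ← hn]
      exact le_iSup (fun n => pathWeight r n s α) n
    · simp [evalProb, h]

end Operational

/-! ## Matrices -/

section Matrices

variable {I J : Type}

theorem matApp_sum {K : Type} (c : K → ℝ≥0∞) (t : K → I × J → ℝ≥0∞) (u : I → ℝ≥0∞) :
    matApp (fun p => ∑' k, c k * t k p) u = fun j => ∑' k, c k * matApp (t k) u j := by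
  funext j
  simp only [matApp, ← ENNReal.tsum_mul_right, ← ENNReal.tsum_mul_left]
  rw [ENNReal.tsum_comm]
  simp only [mul_assoc]

theorem matApp_iSup {t : ℕ → I × J → ℝ≥0∞} (ht : Monotone t) (u : I → ℝ≥0∞) :
    matApp (fun p => ⨆ n, t n p) u = fun j => ⨆ n, matApp (t n) u j := by
  funext j
  simp only [matApp, ENNReal.iSup_mul]
  exact tsum_iSup_of_monotone _ fun _ _ h i => mul_le_mul_left (ht h _) _

theorem matApp_mono_left {t t' : I × J → ℝ≥0∞} (h : t ≤ t') (u : I → ℝ≥0∞) :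
    matApp t u ≤ matApp t' u :=
  fun _ => ENNReal.tsum_le_tsum fun _ => mul_le_mul_left (h _) _

theorem prom_mono : Monotone (prom : (I → ℝ≥0∞) → _) :=
  fun _ _ h _ => Finset.prod_le_prod' fun a _ => pow_le_pow_left' (h a) _

theorem prod_iSup_of_monotone (S : Finset I) (f : ℕ → I → ℝ≥0∞) (hf : Monotone f) :
    ∏ a ∈ S, ⨆ n, f n a = ⨆ n, ∏ a ∈ S, f n a := by
  classical
  induction S using Finset.induction_on with
  | empty => simp
  | insert a S ha ih =>
    have hm : Monotone fun n => ∏ a ∈ S, f n a :=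
      fun _ _ h => Finset.prod_le_prod' fun a _ => hf h a
    simp only [Finset.prod_insert ha, ih]
    refine le_antisymm ?_ (iSup_le fun n => mul_le_mul' (le_iSup (fun n => f n a) n)
      (le_iSup (fun n => ∏ a ∈ S, f n a) n))
    -- The product of the two suprema is a double supremum, attained along the diagonal by taking
    -- the larger index.
    simp only [ENNReal.iSup_mul, ENNReal.mul_iSup]
    exact iSup_le fun m => iSup_le fun n => (mul_le_mul' (hf (le_max_left n m) a)
      (hm (le_max_right n m))).trans
      (le_iSup (fun n => f n a * ∏ a ∈ S, f n a) (max n m))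

theorem prom_iSup {x : ℕ → I → ℝ≥0∞} (hx : Monotone x) :
    prom (fun a => ⨆ n, x n a) = fun μ => ⨆ n, prom (x n) μ := by
  funext μ
  simp only [prom, Finsupp.prod, ENNReal.iSup_pow]
  exact prod_iSup_of_monotone _ _ fun _ _ h a => pow_le_pow_left' (hx h a) _

/-- Scott continuity: each monomial commutes with monotone suprema, and so does a sum of nonnegative
terms. -/
theorem matApp_prom_iSup (t : (I →₀ ℕ) × J → ℝ≥0∞) {x : ℕ → I → ℝ≥0∞} (hx : Monotone x) :
    matApp t (prom fun a => ⨆ n, x n a) = fun j => ⨆ n, matApp t (prom (x n)) j := by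
  funext j
  simp only [prom_iSup hx, matApp, ENNReal.mul_iSup]
  exact tsum_iSup_of_monotone _ fun _ _ h μ => mul_le_mul_right (prom_mono (hx h) μ) _

/-- The iterates from `0` of the function induced by a matrix. -/
noncomputable def iter (t : (I →₀ ℕ) × I → ℝ≥0∞) : ℕ → I → ℝ≥0∞
  | 0 => fun _ => 0
  | n + 1 => matApp t (prom (iter t n))

theorem iter_mono (t : (I →₀ ℕ) × I → ℝ≥0∞) : Monotone (iter t) := by
  refine monotone_nat_of_le_succ fun n => ?_
  induction n with
  | zero => exact fun _ => zero_le
  | succ n ih =>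
    exact fun j => ENNReal.tsum_le_tsum fun μ => mul_le_mul_right (prom_mono ih μ) _

theorem matApp_prom_iSup_iter (t : (I →₀ ℕ) × I → ℝ≥0∞) :
    matApp t (prom fun a => ⨆ n, iter t n a) = fun a => ⨆ n, iter t n a := by
  rw [matApp_prom_iSup t (iter_mono t)]
  funext a
  exact Monotone.iSup_nat_add (f := fun n => iter t n a) (fun _ _ h => iter_mono t h a) 1

end Matrices

/-- The vector denoted by a term at a point of its context. -/
noncomputable def value {Γ : List Ty} {σ : Ty} (M : PTm Γ σ) (u : (ctxSem Γ).Web → ℝ≥0∞)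
    (a : σ.sem.Web) : ℝ≥0∞ :=
  serVal (ser M a) u

/-! ## Relations between vectors and closed terms -/

/-- A family of relations between vectors and closed terms, indexed by `W`, which is compatible
with all constructs of the language, labels being interpreted as scalars. -/
structure TermRel {L : Type u} (r : L → ℝ≥0∞) (W : Type) [Preorder W] where
  Rel : W → ∀ {σ : Ty}, (σ.sem.Web → ℝ≥0∞) → Tm L [] σ → Prop
  mono : ∀ {w w' : W} {σ : Ty} {x : σ.sem.Web → ℝ≥0∞} {M : Tm L [] σ},
    w' ≤ w → Rel w x M → Rel w' x M
  num : ∀ (w : W) (n : ℕ), Rel w (σ := Ty.nat) (fun k : ℕ => if k = n then 1 else 0) (.num n)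
  dice : ∀ (w : W) (q : Set.Icc (0 : ℚ) 1), Rel w (σ := Ty.nat)
    (fun k : ℕ => coinWeight q 0 * (if k = 0 then 1 else 0) +
      coinWeight q 1 * (if k = 1 then 1 else 0)) (.dice q)
  bind : ∀ {w : W} {σ : Ty} {x : ℕ → ℝ≥0∞} {M : Tm L [] Ty.nat} {B : Tm L [] σ}
    (K : Stk L σ → Stk L Ty.nat) {y : ℕ → σ.sem.Web → ℝ≥0∞} {T : ℕ → Tm L [] σ},
    (∀ π, step ⟨B, π⟩ = .tau ⟨M, K π⟩) → (∀ n π, step ⟨.num n, K π⟩ = .tau ⟨T n, π⟩) →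
    Rel w (σ := Ty.nat) x M → (∀ n, Rel w (y n) (T n)) → Rel w (fun a => ∑' n, x n * y n a) B
  app : ∀ {w : W} {σ τ : Ty} {t : (σ.sem.Web →₀ ℕ) × τ.sem.Web → ℝ≥0∞} {v : σ.sem.Web → ℝ≥0∞}
    {M : Tm L [] (σ.arr τ)} {N : Tm L [] σ}, Rel w (σ := σ.arr τ) t M → Rel w v N →
    Rel w (matApp t (prom v)) (.app M N)
  lam : ∀ {w : W} {σ τ : Ty} {t : (σ.sem.Web →₀ ℕ) × τ.sem.Web → ℝ≥0∞} {M : Tm L [σ] τ},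
    (∀ w' ≤ w, ∀ v N, Rel w' v N → Rel w' (matApp t (prom v)) (M.inst N)) →
    Rel w (σ := σ.arr τ) t (.lam M)
  fix : ∀ {w : W} {σ : Ty} {t : (σ.sem.Web →₀ ℕ) × σ.sem.Web → ℝ≥0∞} {M : Tm L [] (σ.arr σ)},
    Rel w (σ := σ.arr σ) t M → Rel w (fun a => ⨆ n, iter t n a) (.fix M)
  mark : ∀ {w : W} {σ : Ty} {x : σ.sem.Web → ℝ≥0∞} {M : Tm L [] σ} (l : L),
    Rel w x M → Rel w (fun a => r l * x a) (.mark M l)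

/-! ### The clauses of the interpretation as operations on vectors -/

section Values

variable {Γ : List Ty} (u : (ctxSem Γ).Web → ℝ≥0∞)

/-- The clauses for `succ`, `pred`, `letin` and `ifz` are all brought to the form `∑ n, x n * y n
a`, so that `TermRel.bind` covers the four constructs that first evaluate an integer. -/
theorem value_succ (M : PTm Γ Ty.nat) :
    value (.succ M) u =
      fun k : ℕ => ∑' n : ℕ, value M u n * (if k = n + 1 then 1 else 0) := by
  funext (k : ℕ)
  simp only [value, ser, serVal_sum, mul_ite, mul_one, mul_zero]
  refine tsum_congr fun n => ?_
  split_ifs <;> simp [serVal_zero]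

theorem value_pred (M : PTm Γ Ty.nat) :
    value (.pred M) u =
      fun k : ℕ => ∑' n : ℕ, value M u n * (if k = n - 1 then 1 else 0) := by
  funext (k : ℕ)
  simp only [value, ser, serVal_sum, mul_ite, mul_one, mul_zero]
  refine tsum_congr fun n => ?_
  split_ifs <;> simp [serVal_zero]

theorem value_dice (q : Set.Icc (0 : ℚ) 1) :
    value (.dice q : PTm Γ Ty.nat) u =
      fun k : ℕ => coinWeight q 0 * (if k = 0 then 1 else 0) +
        coinWeight q 1 * (if k = 1 then 1 else 0) := by
  funext (k : ℕ)
  simp only [value, ser, serVal_add, serVal_smul, serVal_num]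
  rfl

theorem value_letin {σ : Ty} (M : PTm Γ Ty.nat) (N : PTm (Ty.nat :: Γ) σ) :
    value (.letin M N) u = fun a => ∑' n : ℕ, value M u n *
      value N (Sum.elim (fun k : ℕ => if k = n then 1 else 0) u) a := by
  funext a
  simp only [value, ser, serVal_sum, serVal_mul]
  refine tsum_congr fun n => ?_
  congr 1
  refine (serVal_app u _ _ a).trans ((serVal_lam u (ser N) _ a).trans ?_)
  exact congrArg (fun v => serVal (ser N a) (Sum.elim v u)) (funext fun k => serVal_num u n k)

theorem value_ifz {σ : Ty} (M : PTm Γ Ty.nat) (N P : PTm Γ σ) :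
    value (.ifz M N P) u = fun a => ∑' n : ℕ, value M u n *
      (if n = 0 then value N u else value P u) a := by
  funext a
  rw [tsum_eq_zero_add' ENNReal.summable]
  simp [value, ser, serVal_add, serVal_mul, serVal_sum, ENNReal.tsum_mul_right]

theorem value_app {σ τ : Ty} (M : PTm Γ (σ.arr τ)) (N : PTm Γ σ) :
    value (.app M N) u = matApp (value M u) (prom (value N u)) := by
  funext c
  exact serVal_app u (ser M) (ser N) c

theorem matApp_value_lam {σ τ : Ty} (M : PTm (σ :: Γ) τ) (v : σ.sem.Web → ℝ≥0∞) :
    matApp (value (.lam M) u) (prom v) = value M (Sum.elim v u) := by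
  funext c
  exact serVal_lam u (ser M) v c

theorem value_fix {σ : Ty} (M : PTm Γ (σ.arr σ)) :
    value (.fix M) u = fun a => ⨆ n, iter (value M u) n a := by
  funext a
  refine (serVal_fix u (ser M) a).trans (iSup_congr fun n => ?_)
  induction n generalizing a with
  | zero => exact serVal_zero u
  | succ n ih =>
    rw [Function.iterate_succ_apply']
    refine (serVal_app u (ser M) _ a).trans ?_
    simp only [ih]
    rfl

end Values

/-- Fundamental lemma, by induction on the term. The spy variables live only in the context `Δ` of
the translation, where they have the value `r l` at `0` and `0` elsewhere; on the machine side the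
labels are kept. -/
theorem TermRel.spy {L : Type u} {r : L → ℝ≥0∞} {W : Type} [Preorder W] (R : TermRel r W)
    {Γ Δ : List Ty} {σ : Ty} (M : Tm L Γ σ) (ρ : Ren Γ Δ) (x : L → Var Δ Ty.nat)
    (u : (ctxSem Δ).Web → ℝ≥0∞)
    (hx : ∀ l (k : ℕ), u (varPos (x l) k) = if k = 0 then r l else 0)
    (θ : Sub L Γ []) (w : W)
    (hθ : ∀ σ (y : Var Γ σ), R.Rel w (fun a => u (varPos (ρ σ y) a)) (θ σ y)) :
    R.Rel w (value (M.spy ρ x) u) (M.subst θ) := by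
  have hcons : ∀ {Γ Δ : List Ty} {τ : Ty} (ρ : Ren Γ Δ) (u : (ctxSem Δ).Web → ℝ≥0∞)
      (θ : Sub L Γ []) (w : W),
      (∀ σ (y : Var Γ σ), R.Rel w (fun a => u (varPos (ρ σ y) a)) (θ σ y)) →
      ∀ (v : τ.sem.Web → ℝ≥0∞) N, R.Rel w v N → ∀ σ (y : Var (τ :: Γ) σ),
        R.Rel w (fun a => (Sum.elim v u : (ctxSem (τ :: Δ)).Web → ℝ≥0∞)
          (varPos (ρ.lift τ σ y) a)) (Sub.cons N θ σ y) := by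
    intro Γ Δ τ ρ u θ w hθ v N hN σ y
    cases y with
    | zero => exact hN
    | succ y => exact hθ σ y
  induction M generalizing Δ w with
  | var y =>
    have h : value (Tm.spy ρ x (.var y)) u = fun a => u (varPos (ρ _ y) a) := by
      funext a
      exact serVal_X _ _
    rw [h]
    exact hθ _ y
  | num n =>
    have h : value (Tm.spy ρ x (.num n)) u = fun k : ℕ => if k = n then 1 else 0 := by
      funext k
      exact serVal_num _ _ _
    rw [h]
    exact R.num w n
  | succ M ih =>
    rw [Tm.spy, value_succ]
    exact R.bind Stk.succ (fun _ => rfl) (fun n _ => by cases n <;> rfl) (ih ρ x u hx θ w hθ)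
      fun n => R.num w (n + 1)
  | pred M ih =>
    rw [Tm.spy, value_pred]
    exact R.bind Stk.pred (fun _ => rfl) (fun n _ => by cases n <;> rfl) (ih ρ x u hx θ w hθ)
      fun n => R.num w (n - 1)
  | dice q =>
    rw [Tm.spy, value_dice]
    exact R.dice w q
  | letin M N ihM ihN =>
    rw [Tm.spy, value_letin]
    refine R.bind (Stk.letin (N.subst (θ.lift _))) (fun _ => rfl)
      (T := fun n => (N.subst (θ.lift _)).inst (.num n)) (fun n _ => by cases n <;> rfl)
      (ihM ρ x u hx θ w hθ) fun n => ?_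
    rw [Tm.inst_subst_lift]
    exact ihN (ρ.lift _) (fun l => .succ (x l)) (Sum.elim (fun k : ℕ => if k = n then 1 else 0) u)
      hx (Sub.cons (.num n) θ) w (hcons (τ := Ty.nat) ρ u θ w hθ _ _ (R.num w n))
  | ifz M N P ihM ihN ihP =>
    rw [Tm.spy, value_ifz]
    refine R.bind (Stk.ifz (N.subst θ) (P.subst θ)) (fun _ => rfl)
      (T := fun n => if n = 0 then N.subst θ else P.subst θ) (fun n _ => by cases n <;> rfl)
      (ihM ρ x u hx θ w hθ) fun n => ?_
    split_ifs
    · exact ihN ρ x u hx θ w hθ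
    · exact ihP ρ x u hx θ w hθ
  | app M N ihM ihN =>
    rw [Tm.spy, value_app]
    exact R.app (ihM ρ x u hx θ w hθ) (ihN ρ x u hx θ w hθ)
  | lam M ih =>
    refine R.lam fun w' hw v N hN => ?_
    have h := ih (ρ.lift _) (fun l => .succ (x l)) (Sum.elim v u) hx (Sub.cons N θ) w'
      (hcons ρ u θ w' (fun σ y => R.mono hw (hθ σ y)) v N hN)
    rw [← Tm.inst_subst_lift] at h
    exact Eq.mpr (congrArg (R.Rel w' · _) (matApp_value_lam u _ v)) h
  | fix M ih =>
    rw [Tm.spy, value_fix]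
    exact R.fix (ih ρ x u hx θ w hθ)
  | mark M l ih =>
    have h : value (Tm.spy ρ x (.mark M l)) u = fun a => r l * value (M.spy ρ x) u a := by
      have h' : ∀ k : ℕ, value (.var (x l)) u k = if k = 0 then r l else 0 :=
        fun k => (serVal_X _ _).trans (hx l k)
      rw [Tm.spy, value_ifz]
      funext a
      -- The diverging branch has coefficient `0`, since the spy variable gives no mass to nonzero
      -- integers; the value of `loop` plays no role.
      rw [tsum_eq_single 0 fun n hn => by simp [h', hn]]
      simp [h']
    rw [h]
    exact R.mark l (ih ρ x u hx θ w hθ)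

/-! ## Adequacy -/

section Adequacy

variable {L : Type u} (r : L → ℝ≥0∞)

/-- The vector `x` is a lower bound of the behavior `C`, which maps a stack to the weight of
the convergent runs in this stack. -/
def Below : (σ : Ty) → (σ.sem.Web → ℝ≥0∞) → (Stk L σ → ℝ≥0∞) → Prop
  | .nat, x, C => ∀ π, ∑' n : ℕ, x n * totalWeight r ⟨.num n, π⟩ ≤ C π
  | .arr σ τ, t, C => ∀ (v : σ.sem.Web → ℝ≥0∞) (N : Tm L [] σ),
      Below σ v (fun π => totalWeight r ⟨N, π⟩) →
      Below τ (matApp t (prom v)) fun π => C (.arg N π)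

/-- Linearity of `matApp` in the matrix lets the induction pass arrow types. Behaviors are arbitrary
functions of the stack, so they too can be combined linearly; closure under `0`, scalars and
enlarging the behavior are special cases. -/
theorem Below.sum {σ : Ty} {J : Type} (c : J → ℝ≥0∞) {x : J → σ.sem.Web → ℝ≥0∞}
    {C : J → Stk L σ → ℝ≥0∞} {D : Stk L σ → ℝ≥0∞} (h : ∀ j, Below r σ (x j) (C j))
    (hD : ∀ π, ∑' j, c j * C j π ≤ D π) : Below r σ (fun a => ∑' j, c j * x j a) D := by
  induction σ with
  | nat =>
    intro π
    refine le_trans ?_ (hD π)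
    simp only [← ENNReal.tsum_mul_right]
    rw [ENNReal.tsum_comm]
    refine ENNReal.tsum_le_tsum fun j => ?_
    simp only [mul_assoc, ENNReal.tsum_mul_left]
    exact mul_le_mul_right (h j π) _
  | arr σ τ _ ih =>
    intro v N hN
    have e := matApp_sum c x (prom v)
    exact Eq.mpr (congrArg (Below r τ · _) e) (ih (fun j => h j v N hN) fun π => hD _)

theorem Below.zero {σ : Ty} (D : Stk L σ → ℝ≥0∞) : Below r σ (fun _ => 0) D := by
  have h := Below.sum r (J := Empty) (σ := σ) (D := D) (fun _ => 0) (x := fun _ _ => 0)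
    (C := fun _ _ => 0) (fun j => j.elim) fun π => by simp
  simpa using h

theorem Below.of_mul_le {σ : Ty} (c : ℝ≥0∞) {x : σ.sem.Web → ℝ≥0∞} {C D : Stk L σ → ℝ≥0∞}
    (h : Below r σ x C) (hD : ∀ π, c * C π ≤ D π) : Below r σ (fun a => c * x a) D := by
  have h := Below.sum r (J := Unit) (D := D) (fun _ => c) (fun _ => h) (by simpa using hD)
  simpa using h

theorem Below.of_le {σ : Ty} {x : σ.sem.Web → ℝ≥0∞} {C D : Stk L σ → ℝ≥0∞}
    (h : Below r σ x C) (hD : ∀ π, C π ≤ D π) : Below r σ x D := by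
  simpa using Below.of_mul_le r 1 h (by simpa using hD)

theorem Below.iSup {σ : Ty} {x : ℕ → σ.sem.Web → ℝ≥0∞} (hx : Monotone x)
    {C : Stk L σ → ℝ≥0∞} (h : ∀ n, Below r σ (x n) C) : Below r σ (fun a => ⨆ n, x n a) C := by
  induction σ with
  | nat =>
    intro π
    simp only [ENNReal.iSup_mul]
    refine (tsum_iSup_of_monotone (fun n (k : ℕ) => x n k * totalWeight r ⟨.num k, π⟩)
      fun _ _ h k => mul_le_mul_left (hx h k) _).trans_le ?_
    exact iSup_le fun n => h n π
  | arr σ τ _ ih =>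
    intro v N hN
    exact Eq.mpr (congrArg (Below r τ · _) (matApp_iSup hx (prom v)))
      (ih (fun _ _ hmn => matApp_mono_left (hx hmn) _) fun n => h n v N hN)

theorem totalWeight_num (n : ℕ) :
    totalWeight r ⟨.num n, .nil⟩ = if n = 0 then 1 else 0 := by
  cases n with
  | zero => exact totalWeight_halt r rfl
  | succ n => exact totalWeight_stuck r rfl

/-- The lower bounds of the weights of convergence form a compatible relation. -/
def belowRel : TermRel r Unit where
  Rel _ σ x M := Below r σ x fun π => totalWeight r ⟨M, π⟩
  mono _ h := h
  num _ n π := by simp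
  dice _ q π := by
    beta_reduce
    rw [totalWeight_coin r (s := ⟨.dice q, π⟩) rfl]
    simp only [add_mul, ENNReal.tsum_add, mul_assoc, ENNReal.tsum_mul_left]
    simp
  bind {w σ x M B} K {y T} hB hT hM hy := by
    refine Below.sum r x hy fun π => ?_
    rw [totalWeight_tau r (hB π)]
    refine le_trans (le_of_eq (tsum_congr fun n => ?_)) (hM (K π))
    rw [totalWeight_tau r (hT n π)]
  app {w σ τ t v M N} hM hN := (hM v N hN).of_le r fun π =>
    (totalWeight_tau r (s := ⟨.app M N, π⟩) rfl).ge
  lam {w σ τ t M} h v N hN := (h w le_rfl v N hN).of_le r fun π =>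
    (totalWeight_tau r (s := ⟨.lam M, .arg N π⟩) rfl).ge
  fix {w σ t M} hM := by
    -- It is enough to bound each iterate: `0` is below everything, and the next iterate is below
    -- `M` applied to `fix M`, a state that `fix M` reaches in one step.
    refine Below.iSup r (iter_mono t) fun n => ?_
    induction n with
    | zero => exact Below.zero r _
    | succ n ih =>
      exact (hM _ _ ih).of_le r fun π => (totalWeight_tau r (s := ⟨.fix M, π⟩) rfl).ge
  mark {w σ x M} l h := h.of_mul_le r _ fun π =>
    (totalWeight_tick r (s := ⟨.mark M l, π⟩) rfl).ge

/-- The vector `x` is an upper bound of the behavior `C` for runs of at most `k` steps. -/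
def Above : (σ : Ty) → ℕ → (σ.sem.Web → ℝ≥0∞) → (ℕ → Stk L σ → ℝ≥0∞) → Prop
  | .nat, k, x, C => ∀ i ≤ k, ∀ π, C i π ≤ ∑' n : ℕ, x n * runWeight r i ⟨.num n, π⟩
  | .arr σ τ, k, t, C => ∀ i ≤ k, ∀ (v : σ.sem.Web → ℝ≥0∞) (N : Tm L [] σ),
      Above σ i v (fun j π => runWeight r j ⟨N, π⟩) →
      Above τ i (matApp t (prom v)) fun j π => C j (.arg N π)

theorem Above.mono {σ : Ty} {k k' : ℕ} (hk : k' ≤ k) {x : σ.sem.Web → ℝ≥0∞}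
    {C : ℕ → Stk L σ → ℝ≥0∞} (h : Above r σ k x C) : Above r σ k' x C := by
  cases σ with
  | nat => exact fun i hi => h i (hi.trans hk)
  | arr σ τ => exact fun i hi => h i (hi.trans hk)

/-- Without fuel no run converges, so any vector is an upper bound. This starts the induction on
fuel for `fix`. -/
theorem Above.zero {σ : Ty} (x : σ.sem.Web → ℝ≥0∞) {C : ℕ → Stk L σ → ℝ≥0∞}
    (hC : ∀ π, C 0 π = 0) : Above r σ 0 x C := by
  induction σ with
  | nat =>
    intro i hi π
    rw [Nat.le_zero.1 hi, hC]
    exact zero_le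
  | arr σ τ _ ih =>
    intro i hi v N _
    rw [Nat.le_zero.1 hi]
    exact ih _ fun π => hC _

/-- The machine step from `D` to the `C j` consumes one unit of fuel, so the index rises from `k` to
`k + 1`. Only `fix` needs this gain; the other constructs drop it by `Above.mono`. -/
theorem Above.sum {σ : Ty} {k : ℕ} {J : Type} (c : J → ℝ≥0∞) {x : J → σ.sem.Web → ℝ≥0∞}
    {C : J → ℕ → Stk L σ → ℝ≥0∞} {D : ℕ → Stk L σ → ℝ≥0∞} (h : ∀ j, Above r σ k (x j) (C j))
    (hD₀ : ∀ π, D 0 π = 0) (hD : ∀ i ≤ k, ∀ π, D (i + 1) π ≤ ∑' j, c j * C j i π) :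
    Above r σ (k + 1) (fun a => ∑' j, c j * x j a) D := by
  induction σ generalizing k with
  | nat =>
    intro i hi π
    cases i with
    | zero => rw [hD₀]; exact zero_le
    | succ i =>
      have hi : i ≤ k := Nat.le_of_succ_le_succ hi
      refine (hD i hi π).trans ?_
      simp only [← ENNReal.tsum_mul_right]
      rw [ENNReal.tsum_comm]
      refine ENNReal.tsum_le_tsum fun j => ?_
      simp only [mul_assoc, ENNReal.tsum_mul_left]
      refine mul_le_mul_right ((h j i hi π).trans ?_) _
      exact ENNReal.tsum_le_tsum fun n => mul_le_mul_right (runWeight_mono r _ i.le_succ) _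
  | arr σ τ _ ih =>
    intro i hi v N hN
    cases i with
    | zero => exact Above.zero r _ fun π => hD₀ _
    | succ i =>
      have hi : i ≤ k := Nat.le_of_succ_le_succ hi
      have e := matApp_sum c x (prom v)
      exact Eq.mpr (congrArg (Above r τ (i + 1) · _) e)
        (ih (fun j => h j i hi v N (hN.mono r i.le_succ)) (fun π => hD₀ _)
          fun i' hi' π => hD i' (hi'.trans hi) _)

theorem Above.of_le_mul {σ : Ty} {k : ℕ} (c : ℝ≥0∞) {x : σ.sem.Web → ℝ≥0∞}
    {C D : ℕ → Stk L σ → ℝ≥0∞} (h : Above r σ k x C)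
    (hD₀ : ∀ π, D 0 π = 0) (hD : ∀ i ≤ k, ∀ π, D (i + 1) π ≤ c * C i π) :
    Above r σ (k + 1) (fun a => c * x a) D := by
  have h := Above.sum r (J := Unit) (D := D) (fun _ => c) (fun _ => h) hD₀ (by simpa using hD)
  simpa using h

theorem Above.of_le {σ : Ty} {k : ℕ} {x : σ.sem.Web → ℝ≥0∞}
    {C D : ℕ → Stk L σ → ℝ≥0∞} (h : Above r σ k x C)
    (hD₀ : ∀ π, D 0 π = 0) (hD : ∀ i ≤ k, ∀ π, D (i + 1) π ≤ C i π) :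
    Above r σ (k + 1) x D := by
  simpa using Above.of_le_mul r 1 h hD₀ (by simpa using hD)

/-- The upper bounds of the weights of convergence form a compatible relation. -/
def aboveRel : TermRel r ℕ where
  Rel k σ x M := Above r σ k x fun i π => runWeight r i ⟨M, π⟩
  mono hk h := h.mono r hk
  num _ n i _ π := by simp
  dice k q i _ π := by
    cases i with
    | zero => simp [runWeight_zero]
    | succ i =>
      beta_reduce
      rw [runWeight_coin r (s := ⟨.dice q, π⟩) rfl]
      simp only [add_mul, ENNReal.tsum_add, mul_assoc, ENNReal.tsum_mul_left]
      simp only [ite_mul, one_mul, zero_mul, tsum_ite_eq]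
      gcongr <;> exact runWeight_mono r _ i.le_succ
  bind {k σ x M B} K {y T} hB hT hM hy := by
    refine Above.mono r k.le_succ (Above.sum r x hy (fun π => runWeight_zero r _)
      fun i hi π => ?_)
    rw [runWeight_tau r (hB π)]
    refine (hM i hi (K π)).trans (ENNReal.tsum_le_tsum fun n => mul_le_mul_right ?_ _)
    rw [← runWeight_tau r (hT n π)]
    exact runWeight_mono r _ i.le_succ
  app {k σ τ t v M N} hM hN := by
    refine Above.mono r k.le_succ ((hM k le_rfl v N hN).of_le r
      (fun π => runWeight_zero r _) fun i _ π => ?_)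
    exact (runWeight_tau r (s := ⟨.app M N, π⟩) rfl i).le
  lam {k σ τ t M} h i hi v N hN := by
    refine Above.mono r i.le_succ ((h i hi v N hN).of_le r
      (fun π => runWeight_zero r _) fun i _ π => ?_)
    exact (runWeight_tau r (s := ⟨.lam M, .arg N π⟩) rfl i).le
  fix {k σ t M} hM := by
    -- Induction on fuel: `fix M` unfolds to `M` applied to `fix M` with one unit less, and the
    -- supremum of the iterates is a fixed point of `t`, so the same vector serves at every index.
    suffices h : ∀ i ≤ k, Above r σ i (fun a => ⨆ n, iter t n a)
        fun i π => runWeight r i ⟨.fix M, π⟩ from h k le_rfl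
    intro i hi
    induction i with
    | zero => exact Above.zero r _ fun π => runWeight_zero r _
    | succ i ih =>
      have hi : i ≤ k := (Nat.le_succ i).trans hi
      have h := Eq.mp (congrArg (Above r σ i · _) (matApp_prom_iSup_iter t)) (hM i hi _ _ (ih hi))
      exact h.of_le r (fun π => runWeight_zero r _) fun i _ π =>
        (runWeight_tau r (s := ⟨.fix M, π⟩) rfl i).le
  mark {k σ x M} l h := by
    refine Above.mono r k.le_succ (h.of_le_mul r _ (fun π => runWeight_zero r _)
      fun i _ π => ?_)
    exact (runWeight_tick r (s := ⟨.mark M l, π⟩) rfl i).le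

/-- Adequacy: the spy translation of a closed term denotes the weight of its convergent runs. -/
theorem value_spy_eq_totalWeight {Δ : List Ty} (M : Tm L [] Ty.nat) (ρ : Ren [] Δ)
    (x : L → Var Δ Ty.nat) (u : (ctxSem Δ).Web → ℝ≥0∞)
    (hx : ∀ l (k : ℕ), u (varPos (x l) k) = if k = 0 then r l else 0) :
    value (M.spy ρ x) u (0 : ℕ) = totalWeight r (start M) := by
  -- On the empty stack only the numeral `0` converges, so testing there extracts the coefficient at
  -- `0`.
  have e (x : ℕ → ℝ≥0∞) : ∑' n : ℕ, x n * totalWeight r ⟨.num n, .nil⟩ = x 0 := by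
    simp [totalWeight_num]
  have hθ : M.subst (fun _ y => nomatch y : Sub L [] []) = M := M.subst_closed _
  refine le_antisymm ?_ (iSup_le fun k => ?_)
  · have h := (belowRel r).spy M ρ x u hx (fun _ y => nomatch y) () (fun _ y => nomatch y)
    rw [hθ] at h
    exact (e _).ge.trans (h .nil)
  · have h := (aboveRel r).spy M ρ x u hx (fun _ y => nomatch y) k (fun _ y => nomatch y)
    rw [hθ] at h
    refine (h k le_rfl .nil).trans (le_of_le_of_eq ?_ (e _))
    exact ENNReal.tsum_le_tsum fun n => mul_le_mul_right
      (le_iSup (fun k => runWeight r k ⟨.num n, .nil⟩) k) _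

end Adequacy

/-! ### The spy function and the stripped term as weights of runs -/

theorem basePoint_natVar : (n : ℕ) → (r : Fin n → unitInterval) → (i : Fin n) → (k : ℕ) →
    (basePoint n r).1 (varPos (natVar n i) k) = if k = 0 then ENNReal.ofReal (r i) else 0
  | _ + 1, _, ⟨0, _⟩, _ => rfl
  | n + 1, r, ⟨i + 1, h⟩, k =>
    basePoint_natVar n (fun i => r i.succ) ⟨i, Nat.lt_of_succ_lt_succ h⟩ k

theorem sem_spyClosed {L : Type u} {n : ℕ} (e : L ≃ Fin n) (M : Tm L [] Ty.nat)
    (r : L → unitInterval) :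
    ((sem (spyClosed e M)).toFun (basePoint n fun i => r (e.symm i))).1 (0 : ℕ) =
      totalWeight (fun l => ENNReal.ofReal (r l)) (start M) :=
  value_spy_eq_totalWeight _ M _ _ _ fun l k => by
    rw [basePoint_natVar, e.symm_apply_apply]

theorem semClosed_strip {L : Type u} (M : Tm L [] Ty.nat) :
    (semClosed M.strip).1 (0 : ℕ) = ∑' α, evalProb (start M).strip α := by
  -- Adequacy over the empty set of labels, where the spy translation is the identity and the choice
  -- of weights is immaterial.
  have h := value_spy_eq_totalWeight (fun _ => 0) M.strip (fun _ y => y) Empty.elim Empty.elim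
    fun l => l.elim
  rw [Tm.spy_of_isEmpty, totalWeight_eq_tsum] at h
  refine h.trans (tsum_congr fun α => ?_)
  have h1 : (start M.strip).strip = (start M).strip := by
    simp only [State.strip, start, Tm.strip_of_isEmpty]
    rfl
  rw [h1, Subsingleton.elim (evalLabels (start M.strip) α) 0]
  simp [labelWeight]

/-! ## Derivative at `1` of a generating function -/

/-- The geometric sum, stated additively because subtraction in `ℝ≥0∞` is truncated. -/
theorem one_sub_mul_geom_sum (t : unitInterval) (k : ℕ) :
    ENNReal.ofReal t ^ k + (1 - ENNReal.ofReal t) * ∑ i ∈ Finset.range k, ENNReal.ofReal t ^ i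
      = 1 := by
  have ht : ENNReal.ofReal t ≤ 1 := ENNReal.ofReal_le_one.2 t.2.2
  induction k with
  | zero => simp
  | succ k ih =>
    rw [Finset.sum_range_succ, mul_add, pow_succ]
    refine Eq.trans ?_ ih
    calc _ = (1 - ENNReal.ofReal t) * ∑ i ∈ Finset.range k, ENNReal.ofReal t ^ i +
          ENNReal.ofReal t ^ k * (ENNReal.ofReal t + (1 - ENNReal.ofReal t)) := by ring
      _ = _ := by rw [add_tsub_cancel_of_le ht, mul_one, add_comm]

section GeneratingFunction

variable {A : Type} (p : A → ℝ≥0∞) (k : A → ℕ)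

/-- The difference quotient between `t` and `1` of `t ↦ ∑ a, p a * t ^ k a`. -/
noncomputable def slopeSeries (t : unitInterval) : ℝ≥0∞ :=
  ∑' a, p a * ∑ i ∈ Finset.range (k a), ENNReal.ofReal t ^ i

theorem tsum_eq_add_slopeSeries (t : unitInterval) :
    ∑' a, p a = ∑' a, p a * ENNReal.ofReal t ^ k a +
      (1 - ENNReal.ofReal t) * slopeSeries p k t := by
  rw [slopeSeries, ← ENNReal.tsum_mul_left, ← ENNReal.tsum_add]
  refine tsum_congr fun a => ?_
  rw [mul_left_comm, ← mul_add, one_sub_mul_geom_sum, mul_one]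

theorem slopeSeries_one : slopeSeries p k 1 = ∑' a, p a * k a := by
  simp [slopeSeries]

/-- A sum of continuous nonnegative functions is lower semicontinuous, and this one never exceeds
its value at `1`. The two facts give the limit even when it is infinite, with no domination; `hp`
makes every `p a` finite, hence every term continuous. -/
theorem tendsto_slopeSeries (hp : ∑' a, p a ≠ ⊤) :
    Filter.Tendsto (slopeSeries p k) (𝓝 1) (𝓝 (∑' a, p a * k a)) := by
  rw [← slopeSeries_one]
  have hl : LowerSemicontinuous (slopeSeries p k) :=
    lowerSemicontinuous_tsum fun a => Continuous.lowerSemicontinuous <|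
      (ENNReal.continuous_const_mul (ENNReal.ne_top_of_tsum_ne_top hp a)).comp <|
        continuous_finsetSum _ fun i _ => (ENNReal.continuous_pow i).comp <|
          ENNReal.continuous_ofReal.comp continuous_subtype_val
  refine tendsto_order.2 ⟨fun b hb => hl 1 b hb, fun b hb => Filter.Eventually.of_forall
    fun t => lt_of_le_of_lt ?_ hb⟩
  refine ENNReal.tsum_le_tsum fun a => mul_le_mul_right (Finset.sum_le_sum fun i _ => ?_) _
  exact pow_le_pow_left' (ENNReal.ofReal_le_ofReal t.2.2) i

theorem tendsto_slope (hp : ∑' a, p a ≠ ⊤) :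
    Filter.Tendsto (fun t : unitInterval =>
      ((((∑' a, p a * ENNReal.ofReal t ^ k a).toReal - (∑' a, p a).toReal) / ((t : ℝ) - 1) : ℝ) :
        EReal)) (𝓝[≠] 1) (𝓝 ((∑' a, p a * k a : ℝ≥0∞) : EReal)) := by
  have h : Filter.Tendsto (fun t => (slopeSeries p k t : EReal)) (𝓝[≠] 1)
      (𝓝 ((∑' a, p a * k a : ℝ≥0∞) : EReal)) :=
    (continuous_coe_ennreal_ereal.tendsto _).comp
      ((tendsto_slopeSeries p k hp).mono_left nhdsWithin_le_nhds)
  refine h.congr' ?_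
  filter_upwards [self_mem_nhdsWithin] with t ht
  have ht1 : (t : ℝ) < 1 := lt_of_le_of_ne t.2.2 fun e => ht (Subtype.ext e)
  have h1 : 1 - ENNReal.ofReal t = ENNReal.ofReal (1 - t) := by
    rw [ENNReal.ofReal_sub _ t.2.1, ENNReal.ofReal_one]
  have e := tsum_eq_add_slopeSeries p k t
  rw [h1] at e
  have hlt : ∑' a, p a * ENNReal.ofReal t ^ k a ≠ ⊤ := ne_top_of_le_ne_top hp (e ▸ le_self_add)
  have hmt : ENNReal.ofReal (1 - t) * slopeSeries p k t ≠ ⊤ :=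
    ne_top_of_le_ne_top hp (e ▸ le_add_self)
  -- For `t < 1` the quotient is finite even if its limit is not: its product with the nonzero
  -- number `1 - t` is at most the finite sum of the `p a`. Passing to real numbers therefore loses
  -- nothing.
  have hst : slopeSeries p k t ≠ ⊤ := fun h => hmt <| by
    rw [h, ENNReal.mul_top (by simpa using ht1)]
  have hr : (∑' a, p a).toReal = (∑' a, p a * ENNReal.ofReal t ^ k a).toReal +
      (1 - t) * (slopeSeries p k t).toReal := by
    rw [e, ENNReal.toReal_add hlt hmt, ENNReal.toReal_mul, ENNReal.toReal_ofReal (by linarith)]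
  have hq : ((∑' a, p a * ENNReal.ofReal t ^ k a).toReal - (∑' a, p a).toReal) / ((t : ℝ) - 1) =
      (slopeSeries p k t).toReal := by
    rw [div_eq_iff (by linarith), hr]
    ring
  rw [hq, EReal.coe_ennreal_toReal hst]

end GeneratingFunction

/-! ## The conditional expectation of the number of labels -/

theorem lintegral_proba (s : State Empty) (f : Cantor → ℝ≥0∞) :
    ∫⁻ α, f α ∂(proba s) = ∑' α, f α * density s α := by
  rw [MeasureTheory.lintegral_countable']
  refine tsum_congr fun α => ?_
  exact congrArg (f α * ·) (PMF.toMeasure_apply_singleton _ _ MeasurableSet.of_discrete)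

theorem lintegral_converges (s : State Empty) (f : Cantor → ℝ≥0∞) :
    ∫⁻ α in converges s, f α ∂(proba s) = ∑' β, f (0 :: β) * evalProb s β := by
  classical
  rw [← MeasureTheory.lintegral_indicator MeasurableSet.of_discrete, lintegral_proba, tsum_cantor]
  have h0 : ∀ β, (converges s).indicator f (0 :: β) * density s (0 :: β) =
      f (0 :: β) * evalProb s β := by
    intro β
    by_cases hβ : β ∈ evalDom s
    · rw [Set.indicator_of_mem (show 0 :: β ∈ converges s from ⟨β, hβ, rfl⟩)]
      rfl
    -- Outside the domain of evaluation the density vanishes, so the indicator may be dropped.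
    · have : evalProb s β = 0 := dif_neg hβ
      simp [density, this]
  have h1 : ∀ β, (converges s).indicator f (1 :: β) = 0 := fun β =>
    Set.indicator_of_notMem (by rintro ⟨γ, _, h⟩; simp at h) _
  have hnil : density s [] = 0 := rfl
  simp only [h0, h1, hnil, mul_zero, zero_mul, tsum_zero, zero_add, add_zero]

theorem proba_converges (s : State Empty) : proba s (converges s) = ∑' β, evalProb s β := by
  have h := lintegral_converges s fun _ => 1
  simpa using h

/-- Conditioning divides by the probability of convergence. If it is `0`, the numerator vanishes
too, and `0 / 0 = 0` in `ℝ≥0∞` is the convention wanted. -/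
theorem condMeanCount_eq {L : Type u} (s : State L) (l : L) :
    condMeanCount s l =
      (∑' β, evalProb s.strip β * (evalLabels s β l : ℝ≥0∞)) / ∑' β, evalProb s.strip β := by
  rw [condMeanCount, ProbabilityTheory.cond, MeasureTheory.lintegral_smul_measure,
    lintegral_converges, proba_converges, smul_eq_mul, ENNReal.div_eq_inv_mul]
  congr 1
  exact tsum_congr fun β => mul_comm _ _

theorem labelWeight_update_one {L : Type u} [DecidableEq L] (l : L) (t : unitInterval)
    (μ : L →₀ ℕ) :
    labelWeight (fun l' => ENNReal.ofReal (Function.update (fun _ => (1 : unitInterval)) l t l')) μ =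
      ENNReal.ofReal t ^ μ l := by
  rw [labelWeight, Finsupp.prod]
  by_cases hl : l ∈ μ.support
  · rw [Finset.prod_eq_single_of_mem l hl fun l' _ hne => by simp [Function.update_of_ne hne]]
    simp
  · rw [Finset.prod_eq_one fun l' hl' => ?_, Finsupp.notMem_support_iff.1 hl, pow_zero]
    have hne : l' ≠ l := fun h => hl (h ▸ hl')
    simp [Function.update_of_ne hne]

theorem spyFun_update_one {L : Type u} [DecidableEq L] {n : ℕ} (e : L ≃ Fin n)
    (M : Tm L [] Ty.nat) (l : L) (t : unitInterval) :
    spyFun e M (Function.update (fun _ => 1) l t) =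
      (∑' β, evalProb (start M).strip β *
        ENNReal.ofReal t ^ evalLabels (start M) β l).toReal := by
  rw [spyFun, sem_spyClosed, totalWeight_eq_tsum]
  simp only [labelWeight_update_one]

end PPCF

theorem mainTheorem1 {L : Type u} [DecidableEq L] {n : ℕ} (e : L ≃ Fin n)
    (M : PPCF.Tm L [] PPCF.Ty.nat) (l : L) :
    ∃ D : ℝ≥0∞,
      PPCF.HasPartialDeriv (PPCF.spyFun e M) l (fun _ => 1) (D : EReal) ∧
      PPCF.condMeanCount (PPCF.start M) l =
        D / (PPCF.semClosed M.strip).1 (0 : ℕ) := by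
  refine ⟨∑' β, PPCF.evalProb (PPCF.start M).strip β * (PPCF.evalLabels (PPCF.start M) β l : ℝ≥0∞),
    ?_, ?_⟩
  · have h := PPCF.tendsto_slope (PPCF.evalProb (PPCF.start M).strip)
      (fun β => PPCF.evalLabels (PPCF.start M) β l)
      (ne_top_of_le_ne_top ENNReal.one_ne_top (PPCF.evalProb_tsum_le _))
    have h1 : PPCF.spyFun e M (fun _ => 1) =
        (∑' β, PPCF.evalProb (PPCF.start M).strip β).toReal := by
      -- Updating the constant point `1` by the value `1` changes nothing, so the case `t = 1` gives
      -- the value at `(1, …, 1)`.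
      have := PPCF.spyFun_update_one e M l 1
      rw [Function.update_eq_self] at this
      simpa using this
    simp only [PPCF.HasPartialDeriv, PPCF.spyFun_update_one, h1]
    exact h
  · rw [PPCF.condMeanCount_eq, PPCF.semClosed_strip]
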